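/- Let $L^2_+(\mathbb S^1)$ be the space of functions $u=\sum_{k\ge 0}\hat u(k)e^{ikx}$ in $L^2(\mathbb S^1)$ (normalized measure $dx/2\pi$, $z=e^{ix}$), let $\Pi\big(\sum_{k\in\mathbb Z}\hat f(k)e^{ikx}\big)=\sum_{k\ge 0}\hat f(k)e^{ikx}$ be the Szegő projector, and for $s\ge 0$ let $H^s_+(\mathbb S^1)=H^s(\mathbb S^1)\cap L^2_+(\mathbb S^1)$ with the norm $\|u\|_{H^s}^2=\sum_{k}(1+k^2)^s|\hat u(k)|^2$. For $u\in H^{1/2}_+(\mathbb S^1)$ let $K_u=T_z^*H_u$ be the shifted Hankel operator on $L^2_+(\mathbb S^1)$, where $H_u(h)=\Pi(u\bar h)$ and $T_z^*h=\Pi(\bar z h)$, and let $$\mathcal L(1)=\{u\in H^{1/2}_+(\mathbb S^1):\ \operatorname{rk}K_u=1\}.$$ For $\alpha\in\mathbb R$ consider the equation $$i\partial_t u=\Pi(|u|^2u)+\alpha\,(u|1),\qquad u(0)=u_0,\qquad (u|1)=\frac1{2\pi}\int_{-\pi}^{\pi}u(e^{ix})\,dx. \qquad (*)$$ A solution is a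 function $u\in C(\mathbb R;H^{1/2}_+(\mathbb S^1))$ that is differentiable in time with values in $L^2(\mathbb S^1)$ and satisfies $(*)$ in $L^2(\mathbb S^1)$ for every $t\in\mathbb R$. **Theorem.** Let $\alpha<0$. 1. For every $u_0\in\mathcal L(1)$ there is exactly one solution $u$ of $(*)$. For every $t\in\mathbb R$ it has the form $u(t)=\dfrac{az+b}{1-pz}$ with $a,b,p\in\mathbb C$ (depending on $t$), $|p|<1$, $a+bp\ne 0$. For every $s\ge\frac12$ there is a constant $C$ such that $\|u(t)\|_{H^s}<C$ for all $t\in\mathbb R$. 2. The constant is uniform on compact sets: for every $K\subset\mathcal L(1)$ that is compact in $H^{1/2}_+(\mathbb S^1)$ and every $s\ge\frac12$ there is a constant $C=C(\alpha,s,K)$ such that for every $u_0\in K$ the solution $u$ of $(*)$ satisfies $\|u(t)\|_{H^s}<C$ for all $t\in\mathbb R$. -/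

import Mathlib

open MeasureTheory Filter Topology
open scoped ENNReal ComplexConjugate

noncomputable section

namespace AlphaSzego

instance factTwoPiPos : Fact (0 < 2 * Real.pi) := ⟨Real.two_pi_pos⟩

/-- The unit circle `𝕊¹`, as `ℝ / 2πℤ`; the point with parameter `x` is `z = e^{ix}`. -/
abbrev Circ : Type := AddCircle (2 * Real.pi)

/-- The normalized measure `dx / 2π` on the circle. -/
abbrev circMeasure : Measure Circ := AddCircle.haarAddCircle

/-- The coordinate function `z = e^{ix}` on the circle. -/
def zFun (x : Circ) : ℂ := fourier 1 x

/-- `L²(𝕊¹)` for the normalized measure. -/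
abbrev L2 : Type := Lp ℂ 2 circMeasure

lemma coeff_add (f g : L2) (k : ℤ) :
    fourierCoeff (f + g : L2) k = fourierCoeff f k + fourierCoeff g k := by
  rw [← fourierBasis_repr, ← fourierBasis_repr, ← fourierBasis_repr, map_add]; rfl

lemma coeff_smul (c : ℂ) (f : L2) (k : ℤ) :
    fourierCoeff (c • f : L2) k = c * fourierCoeff f k := by
  rw [← fourierBasis_repr, ← fourierBasis_repr, map_smul]; rfl

lemma coeff_zero (k : ℤ) : fourierCoeff (0 : L2) k = 0 := by
  rw [← fourierBasis_repr, map_zero]; rfl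

/-- The Hardy space `L²₊(𝕊¹)`: square integrable functions without negative frequencies. -/
def hardy : Submodule ℂ L2 where
  carrier := {f | ∀ k : ℤ, k < 0 → fourierCoeff f k = 0}
  zero_mem' := fun k _ => coeff_zero k
  add_mem' := by
    intro f g hf hg k hk
    rw [coeff_add, hf k hk, hg k hk, add_zero]
  smul_mem' := by
    intro c f hf k hk
    rw [coeff_smul, hf k hk, mul_zero]

/-! ### Sobolev spaces -/

/-- The weighted Fourier coefficients `(1 + k²)^{s/2} û(k)`. -/
def weightedCoeff (s : ℝ) (f : L2) (k : ℤ) : ℂ :=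
  (((1 + (k : ℝ) ^ 2) ^ (s / 2) : ℝ) : ℂ) * fourierCoeff f k

lemma weightedCoeff_add (s : ℝ) (f g : L2) :
    weightedCoeff s (f + g) = weightedCoeff s f + weightedCoeff s g := by
  funext k
  simp only [weightedCoeff, Pi.add_apply, coeff_add, mul_add]

lemma weightedCoeff_smul (s : ℝ) (c : ℂ) (f : L2) :
    weightedCoeff s (c • f) = c • weightedCoeff s f := by
  funext k
  simp only [weightedCoeff, Pi.smul_apply, coeff_smul, smul_eq_mul]
  ring

/-- `H^s₊(𝕊¹) = H^s(𝕊¹) ∩ L²₊(𝕊¹)`, for `s ≥ 0`, as a subspace of `L²(𝕊¹)`. -/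
def hardySobolev (s : ℝ) : Submodule ℂ L2 where
  carrier := {f | f ∈ hardy ∧ Memℓp (weightedCoeff s f) 2}
  zero_mem' := by
    refine ⟨hardy.zero_mem, ?_⟩
    have : weightedCoeff s 0 = 0 := by
      funext k
      change _ * fourierCoeff (0 : L2) k = 0
      rw [coeff_zero, mul_zero]
    rw [this]
    exact zero_memℓp
  add_mem' := by
    rintro f g ⟨hf, hf'⟩ ⟨hg, hg'⟩
    refine ⟨hardy.add_mem hf hg, ?_⟩
    rw [weightedCoeff_add]
    exact hf'.add hg'
  smul_mem' := by
    rintro c f ⟨hf, hf'⟩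
    refine ⟨hardy.smul_mem c hf, ?_⟩
    rw [weightedCoeff_smul]
    exact hf'.const_smul c

/-- The space `H^s₊(𝕊¹)` as a type of its own; it carries the `H^s` norm below, not the norm
of `L²`. -/
def HPlus (s : ℝ) : Type := hardySobolev s

instance (s : ℝ) : AddCommGroup (HPlus s) := inferInstanceAs (AddCommGroup (hardySobolev s))

instance (s : ℝ) : Module ℂ (HPlus s) := inferInstanceAs (Module ℂ (hardySobolev s))

/-- The inclusion `H^s₊ ⊆ L²₊`. -/
def HPlus.toHardy {s : ℝ} (u : HPlus s) : hardy := ⟨u.1, u.2.1⟩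

/-- The inclusion `H^s₊ ⊆ L²`. -/
def HPlus.toL2 {s : ℝ} (u : HPlus s) : L2 := u.1

/-- The linear map `u ↦ ((1 + k²)^{s/2} û(k))_k` from `H^s₊` to `ℓ²(ℤ)`. -/
def HPlus.toSeq (s : ℝ) : HPlus s →ₗ[ℂ] lp (fun _ : ℤ => ℂ) 2 where
  toFun u := ⟨weightedCoeff s u.1, u.2.2⟩
  map_add' u v := Subtype.ext (weightedCoeff_add s u.1 v.1)
  map_smul' c u := Subtype.ext (weightedCoeff_smul s c u.1)

lemma HPlus.toSeq_injective (s : ℝ) : Function.Injective (HPlus.toSeq s) := by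
  intro u v h
  apply Subtype.ext
  apply (fourierBasis (T := 2 * Real.pi)).repr.injective
  ext k
  rw [fourierBasis_repr, fourierBasis_repr]
  have h1 : weightedCoeff s u.1 k = weightedCoeff s v.1 k :=
    congrFun (congrArg Subtype.val h) k
  have h2 : (((1 + (k : ℝ) ^ 2) ^ (s / 2) : ℝ) : ℂ) ≠ 0 := by
    exact_mod_cast (Real.rpow_pos_of_pos (by positivity) _).ne'
  exact mul_left_cancel₀ h2 h1

/-- The `H^s` norm: `‖u‖² = ∑ₖ (1 + k²)^s |û(k)|²`. -/
instance (s : ℝ) : NormedAddCommGroup (HPlus s) :=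
  NormedAddCommGroup.induced (HPlus s) (lp (fun _ : ℤ => ℂ) 2) (HPlus.toSeq s)
    (HPlus.toSeq_injective s)

lemma HPlus.norm_sq (s : ℝ) (u : HPlus s) :
    ‖u‖ ^ 2 = ∑' k : ℤ, (1 + (k : ℝ) ^ 2) ^ s * ‖fourierCoeff u.toL2 k‖ ^ 2 := by
  have h := lp.norm_rpow_eq_tsum (p := 2) (by norm_num) (HPlus.toSeq s u)
  have h0 : ‖u‖ = ‖HPlus.toSeq s u‖ := rfl
  rw [h0]
  simp only [ENNReal.toReal_ofNat, Real.rpow_ofNat] at h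
  rw [h]
  refine tsum_congr fun k => ?_
  change ‖weightedCoeff s u.1 k‖ ^ 2 = _
  have hp : (0 : ℝ) < 1 + (k : ℝ) ^ 2 := by positivity
  rw [weightedCoeff, norm_mul, mul_pow, Complex.norm_real, Real.norm_eq_abs, sq_abs,
    ← Real.rpow_natCast, ← Real.rpow_mul hp.le]
  simp [HPlus.toL2]

/-! ### The Szegő projector -/

/-- The square integrable function with given square summable Fourier coefficients. -/
def ofCoeff (a : lp (fun _ : ℤ => ℂ) 2) : L2 :=
  (fourierBasis (T := 2 * Real.pi)).repr.symm a

lemma coeff_ofCoeff (a : lp (fun _ : ℤ => ℂ) 2) (k : ℤ) : fourierCoeff (ofCoeff a) k = a k := by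
  rw [← fourierBasis_repr, ofCoeff, LinearIsometryEquiv.apply_symm_apply]

/-- The sequence `n ↦ f̂(n)` for `n ≥ 0` and `0` for `n < 0`. -/
def posCoeff (f : Circ → ℂ) (n : ℤ) : ℂ := if 0 ≤ n then fourierCoeff f n else 0

/-- The Szegő projection `Π f = ∑_{n ≥ 0} f̂(n) e^{inx}` of an integrable function `f` whose
coefficients of nonnegative order are square summable, as an element of `L²₊`. -/
def szego (f : Circ → ℂ) (hf : Memℓp (posCoeff f) 2) : hardy :=
  ⟨ofCoeff ⟨posCoeff f, hf⟩, by
    intro k hk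
    rw [coeff_ofCoeff]
    exact if_neg (not_le.mpr hk)⟩

lemma szego_coeff (f : Circ → ℂ) (hf : Memℓp (posCoeff f) 2) (n : ℤ) :
    fourierCoeff (szego f hf : L2) n = posCoeff f n :=
  coeff_ofCoeff _ n

lemma ext_coeff {f g : L2} (h : ∀ k : ℤ, fourierCoeff f k = fourierCoeff g k) : f = g := by
  apply (fourierBasis (T := 2 * Real.pi)).repr.injective
  ext k
  rw [fourierBasis_repr, fourierBasis_repr, h k]

lemma memℓp_coeff (f : L2) : Memℓp (fun n : ℤ => fourierCoeff f n) 2 := by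
  rw [memℓp_gen_iff (by norm_num)]
  simp only [ENNReal.toReal_ofNat, Real.rpow_ofNat]
  exact (hasSum_sq_fourierCoeff f).summable

lemma memℓp_of_norm_le {a b : ℤ → ℂ} (ha : Memℓp a 2) (h : ∀ n, ‖b n‖ ≤ ‖a n‖) :
    Memℓp b 2 := by
  rw [memℓp_gen_iff (by norm_num)] at ha ⊢
  simp only [ENNReal.toReal_ofNat, Real.rpow_ofNat] at ha ⊢
  exact Summable.of_nonneg_of_le (fun n => by positivity)
    (fun n => pow_le_pow_left₀ (norm_nonneg _) (h n) 2) ha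

lemma coeff_toLp {f : Circ → ℂ} (hf : MemLp f 2 circMeasure) (n : ℤ) :
    fourierCoeff (hf.toLp f : L2) n = fourierCoeff f n := by
  have h : (hf.toLp f : Circ → ℂ) =ᵐ[circMeasure] f := hf.coeFn_toLp
  unfold fourierCoeff
  refine integral_congr_ae ?_
  filter_upwards [h] with x hx
  rw [hx]

lemma memℓp_posCoeff_of_memLp {f : Circ → ℂ} (hf : MemLp f 2 circMeasure) :
    Memℓp (posCoeff f) 2 := by
  refine memℓp_of_norm_le (memℓp_coeff (hf.toLp f)) fun n => ?_
  rw [coeff_toLp hf n]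
  unfold posCoeff
  split_ifs
  · exact le_rfl
  · rw [norm_zero]
    exact norm_nonneg _

/-! ### Hankel operators -/

lemma memLp_fourier_mul (n : ℤ) (h : L2) :
    MemLp (fun x => fourier n x * h x) 2 circMeasure := by
  refine (Lp.memLp h).of_le ((fourier n).continuous.aestronglyMeasurable.mul
    (Lp.aestronglyMeasurable h)) (Eventually.of_forall fun x => ?_)
  rw [norm_mul, fourier_apply, Circle.norm_coe, one_mul]

lemma coeff_fourier_mul (n k : ℤ) (h : Circ → ℂ) :
    fourierCoeff (fun x => fourier n x * h x) k = fourierCoeff h (k - n) := by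
  unfold fourierCoeff
  refine integral_congr_ae (Eventually.of_forall fun x => ?_)
  simp only [smul_eq_mul, ← mul_assoc, ← fourier_add]
  congr 3
  ring

/-- The indicator weight used to estimate Hankel operators. -/
def tail (u : L2) (n k : ℤ) : ℝ := if 0 ≤ n ∧ n ≤ k then ‖fourierCoeff u k‖ ^ 2 else 0

lemma tail_nonneg (u : L2) (n k : ℤ) : 0 ≤ tail u n k := by
  unfold tail; split_ifs <;> positivity

lemma summable_tail (u : HPlus (1 / 2)) : Summable fun n : ℤ => ∑' k : ℤ, tail u.toL2 n k := by
  have hsupp : ∀ k : ℤ, ∀ n ∉ Finset.Icc (0 : ℤ) k, tail u.toL2 n k = 0 := by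
    intro k n hn
    exact if_neg fun h => hn (Finset.mem_Icc.mpr h)
  have hw : Summable fun k : ℤ => ‖weightedCoeff (1 / 2) u.toL2 k‖ ^ 2 := by
    have h := u.2.2
    rw [memℓp_gen_iff (by norm_num)] at h
    simp only [ENNReal.toReal_ofNat, Real.rpow_ofNat] at h
    exact h
  have hF : Summable fun p : ℤ × ℤ => tail u.toL2 p.2 p.1 := by
    rw [summable_prod_of_nonneg fun p => tail_nonneg _ _ _]
    refine ⟨fun k => summable_of_ne_finset_zero (hsupp k), ?_⟩
    refine Summable.of_nonneg_of_le (fun k => tsum_nonneg fun n => tail_nonneg _ _ _)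
      (fun k => ?_) (hw.mul_left 2)
    change ∑' n, tail u.toL2 n k ≤ _
    rw [tsum_eq_sum (hsupp k)]
    have h1 : ∑ n ∈ Finset.Icc (0 : ℤ) k, tail u.toL2 n k
        ≤ ∑ n ∈ Finset.Icc (0 : ℤ) k, ‖fourierCoeff u.toL2 k‖ ^ 2 := by
      refine Finset.sum_le_sum fun n _ => ?_
      unfold tail; split_ifs
      · exact le_rfl
      · positivity
    refine h1.trans ?_
    rw [Finset.sum_const, Int.card_Icc, nsmul_eq_mul, weightedCoeff, norm_mul, mul_pow,
      Complex.norm_real, Real.norm_eq_abs, sq_abs, ← mul_assoc]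
    refine mul_le_mul_of_nonneg_right ?_ (by positivity)
    have hp : (0 : ℝ) < 1 + (k : ℝ) ^ 2 := by positivity
    rw [← Real.rpow_natCast, ← Real.rpow_mul hp.le]
    have he : (1 / 2 / 2 * ((2 : ℕ) : ℝ) : ℝ) = 1 / 2 := by norm_num
    rw [he, ← Real.sqrt_eq_rpow]
    have h2 : |(k : ℝ)| ≤ Real.sqrt (1 + (k : ℝ) ^ 2) := Real.abs_le_sqrt (by linarith)
    have h3 : 1 ≤ Real.sqrt (1 + (k : ℝ) ^ 2) := Real.one_le_sqrt.mpr (by nlinarith [sq_nonneg (k : ℝ)])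
    have h4 : ((k + 1 - 0).toNat : ℝ) ≤ |(k : ℝ)| + 1 := by
      have h5 : ((k + 1 - 0).toNat : ℤ) ≤ |k| + 1 := by
        have := le_abs_self k
        have := abs_nonneg k
        omega
      exact_mod_cast h5
    linarith
  have := (hF.prod_symm).prod
  simpa using this

/-- The sequence of Fourier coefficients, as an element of `ℓ²(ℤ)`. -/
def coeffSeq (f : L2) : lp (fun _ : ℤ => ℂ) 2 := ⟨fun n => fourierCoeff f n, memℓp_coeff f⟩

lemma coeffSeq_eq (f : L2) : coeffSeq f = (fourierBasis (T := 2 * Real.pi)).repr f := by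
  ext k
  exact (fourierBasis_repr f k).symm

lemma inner_coeffSeq (f g : L2) : inner ℂ (coeffSeq f) (coeffSeq g) = inner ℂ f g := by
  rw [coeffSeq_eq, coeffSeq_eq, LinearIsometryEquiv.inner_map_map]

lemma norm_coeffSeq (f : L2) : ‖coeffSeq f‖ = ‖f‖ := by
  rw [coeffSeq_eq, LinearIsometryEquiv.norm_map]

lemma norm_coeff_mul_conj_sq_le (u : L2) (h : hardy) {n : ℤ} (hn : 0 ≤ n) :
    ‖fourierCoeff (fun x => u x * conj ((h : L2) x)) n‖ ^ 2
      ≤ ‖h‖ ^ 2 * ∑' k : ℤ, tail u n k := by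
  set g : L2 := (memLp_fourier_mul n (h : L2)).toLp _ with hg
  have hgn : ‖g‖ = ‖h‖ := by
    rw [hg, Lp.norm_toLp, Submodule.coe_norm, Lp.norm_def]
    congr 1
    refine eLpNorm_congr_norm_ae (Eventually.of_forall fun x => ?_)
    rw [norm_mul, fourier_apply, Circle.norm_coe, one_mul]
  have h1 : fourierCoeff (fun x => u x * conj ((h : L2) x)) n = inner ℂ g u := by
    rw [L2.inner_def, fourierCoeff]
    refine integral_congr_ae ?_
    have hx : (g : Circ → ℂ) =ᵐ[circMeasure] fun x => fourier n x * (h : L2) x :=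
      (memLp_fourier_mul n (h : L2)).coeFn_toLp
    filter_upwards [hx] with x hx
    rw [hx]
    simp only [RCLike.inner_apply, map_mul, smul_eq_mul, fourier_neg]
    ring
  have hgc : ∀ k, fourierCoeff g k = fourierCoeff (h : L2) (k - n) := by
    intro k
    exact (coeff_toLp (memLp_fourier_mul n (h : L2)) k).trans (coeff_fourier_mul n k _)
  have hv : Memℓp (fun k : ℤ => if n ≤ k then fourierCoeff u k else 0) 2 := by
    refine memℓp_of_norm_le (memℓp_coeff u) fun k => ?_
    split_ifs
    · exact le_rfl
    · rw [norm_zero]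
      exact norm_nonneg _
  set v : lp (fun _ : ℤ => ℂ) 2 := ⟨_, hv⟩ with hvdef
  have hvk : ∀ k, v k = if n ≤ k then fourierCoeff u k else 0 := fun k => rfl
  have h2 : inner ℂ g u = inner ℂ (coeffSeq g) v := by
    rw [← inner_coeffSeq, lp.inner_eq_tsum, lp.inner_eq_tsum]
    refine tsum_congr fun k => ?_
    rw [hvk]
    split_ifs with hk
    · rfl
    · have h0 : coeffSeq g k = 0 := (hgc k).trans (h.2 (k - n) (by omega))
      rw [h0]
      simp
  have h3 : ‖v‖ ^ 2 = ∑' k : ℤ, tail u n k := by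
    have h := lp.norm_rpow_eq_tsum (p := 2) (by norm_num) v
    simp only [ENNReal.toReal_ofNat, Real.rpow_ofNat] at h
    rw [h]
    refine tsum_congr fun k => ?_
    rw [hvk, tail]
    by_cases hk : n ≤ k
    · rw [if_pos hk, if_pos ⟨hn, hk⟩]
    · rw [if_neg hk, if_neg fun h => hk h.2]
      simp
  rw [h1, h2, ← h3, ← hgn, ← mul_pow, ← norm_coeffSeq g]
  exact pow_le_pow_left₀ (norm_nonneg _) (norm_inner_le_norm _ _) 2

lemma memℓp_hankel (u : HPlus (1 / 2)) (h : hardy) :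
    Memℓp (posCoeff fun x => u.toL2 x * conj ((h : L2) x)) 2 := by
  rw [memℓp_gen_iff (by norm_num)]
  simp only [ENNReal.toReal_ofNat, Real.rpow_ofNat]
  refine Summable.of_nonneg_of_le (fun n => by positivity) (fun n => ?_)
    ((summable_tail u).mul_left (‖h‖ ^ 2))
  unfold posCoeff
  split_ifs with hn
  · exact norm_coeff_mul_conj_sq_le _ _ hn
  · simpa using mul_nonneg (sq_nonneg _) (tsum_nonneg fun k => tail_nonneg _ _ _)

lemma integrable_mul_conj (u h : L2) :
    Integrable (fun x => u x * conj (h x)) circMeasure :=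
  (L2.integrable_inner (𝕜 := ℂ) h u).congr (Eventually.of_forall fun x => by simp)

/-- The Hankel operator `H_u : L²₊ → L²₊`, `H_u h = Π (u h̄)`, which is antilinear. -/
def hankel (u : HPlus (1 / 2)) : hardy →ₛₗ[starRingEnd ℂ] hardy where
  toFun h := szego (fun x => u.toL2 x * conj ((h : L2) x)) (memℓp_hankel u h)
  map_add' h₁ h₂ := by
    apply Subtype.ext
    apply ext_coeff
    intro k
    refine Eq.trans ?_ (coeff_add _ _ k).symm
    rw [szego_coeff, szego_coeff, szego_coeff]
    unfold posCoeff
    split_ifs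
    · have := fourierCoeff.add (integrable_mul_conj u.toL2 (h₁ : L2))
        (integrable_mul_conj u.toL2 (h₂ : L2))
      rw [← Pi.add_apply, ← this]
      refine congrFun (fourierCoeff_congr_ae ?_) k
      filter_upwards [Lp.coeFn_add (h₁ : L2) (h₂ : L2)] with x hx
      simp only [Submodule.coe_add, hx, Pi.add_apply, map_add, mul_add]
    · simp
  map_smul' c h := by
    apply Subtype.ext
    apply ext_coeff
    intro k
    refine Eq.trans ?_ (coeff_smul _ _ k).symm
    rw [szego_coeff, szego_coeff]
    unfold posCoeff
    split_ifs
    · rw [← fourierCoeff.const_mul]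
      refine congrFun (fourierCoeff_congr_ae ?_) k
      filter_upwards [Lp.coeFn_smul c (h : L2)] with x hx
      simp only [Submodule.coe_smul, hx, Pi.smul_apply, smul_eq_mul, map_mul]
      ring
    · simp

/-- The adjoint `T_z^*` of the shift `T_z h = z h` on `L²₊`, that is `T_z^* h = Π (z̄ h)`. -/
def shiftAdjoint : hardy →ₗ[ℂ] hardy where
  toFun h := szego (fun x => fourier (-1) x * (h : L2) x)
    (memℓp_posCoeff_of_memLp (memLp_fourier_mul (-1) (h : L2)))
  map_add' h₁ h₂ := by
    apply Subtype.ext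
    apply ext_coeff
    intro k
    refine Eq.trans ?_ (coeff_add _ _ k).symm
    rw [szego_coeff, szego_coeff, szego_coeff]
    unfold posCoeff
    simp only [coeff_fourier_mul, Submodule.coe_add, coeff_add]
    split_ifs <;> simp
  map_smul' c h := by
    apply Subtype.ext
    apply ext_coeff
    intro k
    refine Eq.trans ?_ (coeff_smul _ _ k).symm
    rw [szego_coeff, szego_coeff]
    unfold posCoeff
    simp only [coeff_fourier_mul, Submodule.coe_smul, coeff_smul]
    split_ifs <;> simp

/-- The shifted Hankel operator `K_u = T_z^* H_u`. -/
def shiftedHankel (u : HPlus (1 / 2)) : hardy →ₛₗ[starRingEnd ℂ] hardy :=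
  shiftAdjoint.comp (hankel u)

/-- The set `𝓛(k) = {u ∈ H^{1/2}₊ : rk K_u = k}`. -/
def rankSet (k : ℕ) : Set (HPlus (1 / 2)) :=
  {u | Module.rank ℂ (LinearMap.range (shiftedHankel u)) = k}

/-! ### The equation -/

/-- `u ∈ C(ℝ; H^{1/2}₊)` is a global solution of `i ∂ₜu = Π(|u|²u) + α (u|1)`, `u(0) = u₀`.
The equation is an identity in `L²(𝕊¹)` for every time; `|u|²u` lies in `L²(𝕊¹)` because
`H^{1/2}(𝕊¹) ⊆ L⁶(𝕊¹)`, and `(u|1)` is the mean value of `u`, a constant function. -/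
structure IsSolution (α : ℝ) (u₀ : HPlus (1 / 2)) (u : ℝ → HPlus (1 / 2)) : Prop where
  continuous : Continuous u
  initial : u 0 = u₀
  equation : ∀ t : ℝ,
    ∃ (hcubic : MemLp (fun x => (‖(u t).toL2 x‖ : ℂ) ^ 2 * (u t).toL2 x) 2 circMeasure) (u' : L2),
      HasDerivAt (fun τ => (u τ).toL2) u' t ∧
      Complex.I • u' =
        (szego (fun x => (‖(u t).toL2 x‖ : ℂ) ^ 2 * (u t).toL2 x)
          (memℓp_posCoeff_of_memLp hcubic) : L2)
        + Lp.const 2 circMeasure ((α : ℂ) * ∫ x, (u t).toL2 x ∂circMeasure)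

/-- `u` belongs to `H^s₊` and `‖u‖_{H^s} < C`. -/
def SobolevNormLT (s : ℝ) (u : L2) (C : ℝ) : Prop := ∃ w : HPlus s, w.toL2 = u ∧ ‖w‖ < C

end AlphaSzego

end

noncomputable section

namespace AlphaSzego

/-! ### Global existence for ordinary differential equations -/

/-! A shifted Hankel operator of rank one forces the Fourier coefficients of positive order to form
a geometric sequence, so the data are the functions u = b + c z / (1 - p z) with |p| < 1 and c ≠ 0
(`exists_params_of_mem_rankSet`). Bounds on b and c together with |p| ≤ r < 1 control every H^s norm
(`exists_sobolevNormLT`), so the danger is that the pole approaches the circle.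

Write c = η (1 - |p|²). By `cubic_identity`, |u|²u + αb is, on this family, i times a velocity
tangent to the family plus a function with strictly negative frequencies, which Π removes. The
equation thus becomes the polynomial system `field` for (p, b, η), and `isSolution_of_trajectory`
leads back from it to the equation. The system conserves the momentum |η|², the mass M = |b|² + |η|²
(1 - |p|²), and `gap`, which equals ½‖u‖⁴ + α|b|² - ½M² - αM with the L⁴ norm. The point is that
`gap` factors as (1 - |p|²) (|η b̄ + |η|² p|² - α|η|²). For α < 0 the second factor is at least
-α|η|² > 0, and mass and momentum bound it from above. Since the product is constant, 1 - |p|² stays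
away from zero, uniformly for compact sets of data (`bounds_of_mem_levelSet`,
`exists_uniform_bound`). The same bounds make the level sets compact, whence global trajectories
(`exists_trajectory`).

Uniqueness has to hold among all H^{1/2} solutions, which need not be bounded functions. The
constructed solution is bounded, however, and this suffices (`IsSolution.eq_of_bounded`): the
squared L² distance g to another solution satisfies |g'| ≤ (A + B √(1 + log N)) g + C / √(1 + N) for
every N, locally in time. The logarithm comes from splitting the difference at frequency N.
Gronwall's inequality costs only the exponential of a multiple of √(log N), which the power of N
beats as N → ∞. -/

/-- A bounded Lipschitz vector field has a global integral curve through every point. -/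
theorem exists_integralCurve_of_lipschitz {E : Type*} [NormedAddCommGroup E] [NormedSpace ℝ E]
    [CompleteSpace E] {f : E → E} {K L : NNReal} (hK : LipschitzWith K f) (hL : ∀ x, ‖f x‖ ≤ L)
    (x₀ : E) : ∃ γ : ℝ → E, γ 0 = x₀ ∧ ∀ t, HasDerivAt γ (f (γ t)) t := by
  have hex : ∀ n : ℕ, ∃ γ : ℝ → E, γ 0 = x₀ ∧
      ∀ t ∈ Set.Icc (-((n : ℝ) + 1)) ((n : ℝ) + 1),
        HasDerivWithinAt γ (f (γ t)) (Set.Icc (-((n : ℝ) + 1)) ((n : ℝ) + 1)) t := by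
    intro n
    have h0 : (0 : ℝ) ∈ Set.Icc (-((n : ℝ) + 1)) ((n : ℝ) + 1) := by
      constructor <;> have := n.cast_nonneg (α := ℝ) <;> linarith
    -- A curve of speed at most L stays within L(n + 1) of `x₀` up to time n + 1, so this radius
    -- never restricts the time of existence.
    have hpl : IsPicardLindelof (fun _ : ℝ => f)
        (⟨0, h0⟩ : Set.Icc (-((n : ℝ) + 1)) ((n : ℝ) + 1)) x₀ (L * (n + 1)) 0 L K := by
      refine IsPicardLindelof.of_time_independent (fun x _ => hL x) hK.lipschitzOnWith ?_
      simp
    exact hpl.exists_eq_forall_mem_Icc_hasDerivWithinAt₀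
  choose γ hγ0 hγ using hex
  have hd : ∀ n : ℕ, ∀ t ∈ Set.Ioo (-((n : ℝ) + 1)) ((n : ℝ) + 1),
      HasDerivAt (γ n) (f (γ n t)) t := fun n t ht =>
    (hγ n t (Set.Ioo_subset_Icc_self ht)).hasDerivAt (Icc_mem_nhds ht.1 ht.2)
  have huniq : ∀ m n : ℕ, m ≤ n →
      Set.EqOn (γ m) (γ n) (Set.Ioo (-((m : ℝ) + 1)) ((m : ℝ) + 1)) := by
    intro m n hmn
    have hmn' : (m : ℝ) ≤ n := Nat.cast_le.mpr hmn
    refine ODE_solution_unique_of_mem_Ioo (v := fun _ => f) (s := fun _ => Set.univ) (K := K)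
      (t₀ := 0) (fun t _ => hK.lipschitzOnWith) ?_ (fun t ht => ⟨hd m t ht, trivial⟩)
      (fun t ht => ⟨hd n t ⟨?_, ?_⟩, trivial⟩) ((hγ0 m).trans (hγ0 n).symm)
    · constructor <;> have := m.cast_nonneg (α := ℝ) <;> linarith
    · linarith [ht.1]
    · linarith [ht.2]
  -- The local curves agree on common intervals and are glued by reading off, at time t, one whose
  -- open interval contains t. Near t all of them agree with a single curve, of index one higher.
  refine ⟨fun t => γ ⌈|t|⌉₊ t, ?_, fun t => ?_⟩
  · exact hγ0 _
  · set n := ⌈|t|⌉₊ + 1 with hn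
    have ht : |t| < n := by
      rw [hn]
      push_cast
      have := Nat.le_ceil |t|
      linarith
    have hmem : ∀ s : ℝ, s ∈ Set.Ioo (-((⌈|s|⌉₊ : ℝ) + 1)) ((⌈|s|⌉₊ : ℝ) + 1) := by
      intro s
      have h1 := Nat.le_ceil |s|
      have h2 := abs_le.mp h1
      constructor <;> linarith [h2.1, h2.2]
    have heq : ∀ s : ℝ, |s| < n → γ ⌈|s|⌉₊ s = γ n s := by
      intro s hs
      exact huniq _ _ (Nat.ceil_le.mpr hs.le) (hmem s)
    have hev : (fun s => γ ⌈|s|⌉₊ s) =ᶠ[𝓝 t] γ n := by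
      have : ∀ᶠ s in 𝓝 t, |s| < (n : ℝ) := continuous_abs.continuousAt.eventually_lt_const ht
      exact this.mono heq
    change HasDerivAt _ (f (γ ⌈|t|⌉₊ t)) t
    rw [heq t ht]
    refine (hd n t ?_).congr_of_eventuallyEq hev
    have := abs_lt.mp ht
    constructor <;> linarith [this.1, this.2]

/-- If a compact set is invariant under every rescaling of a `C¹` vector field, then the vector
field has a global integral curve through each of its points, which stays in the set. -/
theorem exists_integralCurve_of_invariant_compact {E : Type*} [NormedAddCommGroup E]
    [NormedSpace ℝ E] [FiniteDimensional ℝ E] {f : E → E} (hf : ContDiff ℝ 1 f) {S : Set E}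
    (hS : IsCompact S) {x₀ : E}
    (hinv : ∀ (φ : ℝ → ℝ) (γ : ℝ → E), γ 0 = x₀ → (∀ t, HasDerivAt γ (φ t • f (γ t)) t) →
      ∀ t, γ t ∈ S) :
    ∃ γ : ℝ → E, γ 0 = x₀ ∧ (∀ t, HasDerivAt γ (f (γ t)) t) ∧ ∀ t, γ t ∈ S := by
  have : CompleteSpace E := FiniteDimensional.complete ℝ E
  obtain ⟨R, hR, hSR⟩ := hS.isBounded.subset_closedBall_lt 0 0
  -- The cutoff makes the field compactly supported, hence bounded and globally Lipschitz. Its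
  -- integral curve solves the equation rescaled by φ(γ t), so by hypothesis it stays in S, where
  -- the factor is 1.
  let φ : ContDiffBump (0 : E) := ⟨R, R + 1, hR, by linarith⟩
  have hg : ContDiff ℝ 1 fun x => φ x • f x := φ.contDiff.smul hf
  have hgs : HasCompactSupport fun x => φ x • f x := φ.hasCompactSupport.smul_right
  obtain ⟨K, hK⟩ := hg.lipschitzWith_of_hasCompactSupport hgs one_ne_zero
  obtain ⟨C, hC⟩ := hg.continuous.bounded_above_of_compact_support hgs
  have hC' : ∀ x, ‖φ x • f x‖ ≤ C.toNNReal := fun x =>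
    (hC x).trans (Real.le_coe_toNNReal C)
  obtain ⟨γ, hγ0, hγ⟩ := exists_integralCurve_of_lipschitz hK hC' x₀
  have hγS := hinv (fun t => φ (γ t)) γ hγ0 hγ
  refine ⟨γ, hγ0, fun t => ?_, hγS⟩
  have h1 : φ (γ t) = 1 := φ.one_of_mem_closedBall (hSR (hγS t))
  simpa [h1] using hγ t

/-! ### The equation in coordinates -/

/-- The vector field of the equation in the coordinates `(p, b, η)` of
`u = b + η (1 - |p|²) z / (1 - p z)`. -/
def field (α : ℝ) (x : ℂ × ℂ × ℂ) : ℂ × ℂ × ℂ :=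
  let p := x.1
  let b := x.2.1
  let e := x.2.2
  (-Complex.I * ((1 - p * conj p) * (e * conj b + e * conj e * p)),
    -Complex.I * ((b * conj b + 2 * (e * conj e) * (1 - p * conj p) + α) * b
      + e * conj e * e * (1 - p * conj p) * conj p),
    -Complex.I * (e * (2 * (b * conj b) + e * conj e + conj p * e * conj b + p * conj e * b)))

lemma contDiff_field (α : ℝ) : ContDiff ℝ 1 (field α) := by
  have hc : ContDiff ℝ 1 (fun z : ℂ => conj z) := Complex.conjCLE.contDiff
  have h1 : ContDiff ℝ 1 (fun x : ℂ × ℂ × ℂ => x.1) := contDiff_fst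
  have h2 : ContDiff ℝ 1 (fun x : ℂ × ℂ × ℂ => x.2.1) := contDiff_fst.comp contDiff_snd
  have h3 : ContDiff ℝ 1 (fun x : ℂ × ℂ × ℂ => x.2.2) := contDiff_snd.comp contDiff_snd
  have h1c := hc.comp h1
  have h2c := hc.comp h2
  have h3c := hc.comp h3
  simp only [Function.comp_def] at h1c h2c h3c
  unfold field
  fun_prop

/-- The momentum `|η|²`. -/
def momentum (x : ℂ × ℂ × ℂ) : ℂ := x.2.2 * conj x.2.2

/-- The mass `|b|² + |η|² (1 - |p|²)`. -/
def mass (x : ℂ × ℂ × ℂ) : ℂ := x.2.1 * conj x.2.1 + x.2.2 * conj x.2.2 * (1 - x.1 * conj x.1)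

/-- A combination of the energy and the mass that controls the distance of `p` to the circle. -/
def gap (α : ℝ) (x : ℂ × ℂ × ℂ) : ℂ :=
  (1 - x.1 * conj x.1) *
    ((x.2.2 * conj x.2.1 + x.2.2 * conj x.2.2 * x.1)
      * (conj x.2.2 * x.2.1 + x.2.2 * conj x.2.2 * conj x.1) - α * (x.2.2 * conj x.2.2))

/-! ### Conservation laws of the system in coordinates -/

section Conservation

variable {α : ℝ} {φ : ℝ → ℝ} {γ : ℝ → ℂ × ℂ × ℂ}

lemma hasDerivAt_coords {t : ℝ} {v : ℂ × ℂ × ℂ} (hγ : HasDerivAt γ v t) :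
    HasDerivAt (fun t => (γ t).1) v.1 t ∧ HasDerivAt (fun t => (γ t).2.1) v.2.1 t ∧
      HasDerivAt (fun t => (γ t).2.2) v.2.2 t :=
  ⟨hγ.fst, hγ.snd.fst, hγ.snd.snd⟩

lemma hasDerivAt_conj {f : ℝ → ℂ} {f' : ℂ} {t : ℝ} (h : HasDerivAt f f' t) :
    HasDerivAt (fun t => conj (f t)) (conj f') t := h.star

lemma eq_of_hasDerivAt_zero {g : ℝ → ℂ} (h : ∀ t, HasDerivAt g 0 t) (t : ℝ) : g t = g 0 :=
  is_const_of_deriv_eq_zero (fun s => (h s).differentiableAt) (fun s => (h s).deriv) t 0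

/-- The derivative along `field` vanishes identically as a polynomial in the coordinates and their
conjugates. A real factor φ only rescales that derivative, so the law survives the cutoff used to
construct global curves. -/
lemma momentum_conserved (hγ : ∀ t, HasDerivAt γ (φ t • field α (γ t)) t) (t : ℝ) :
    momentum (γ t) = momentum (γ 0) := by
  refine eq_of_hasDerivAt_zero (g := fun t => momentum (γ t)) (fun t => ?_) t
  obtain ⟨-, -, h3⟩ := hasDerivAt_coords (hγ t)
  refine (h3.mul (hasDerivAt_conj h3)).congr_deriv ?_
  simp [field, Complex.conj_ofNat]
  ring

lemma mass_conserved (hγ : ∀ t, HasDerivAt γ (φ t • field α (γ t)) t) (t : ℝ) :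
    mass (γ t) = mass (γ 0) := by
  refine eq_of_hasDerivAt_zero (g := fun t => mass (γ t)) (fun t => ?_) t
  obtain ⟨h1, h2, h3⟩ := hasDerivAt_coords (hγ t)
  refine ((h2.mul (hasDerivAt_conj h2)).add
    ((h3.mul (hasDerivAt_conj h3)).mul ((h1.mul (hasDerivAt_conj h1)).const_sub 1))).congr_deriv ?_
  simp [field, Complex.conj_ofNat]
  ring

lemma gap_conserved (hγ : ∀ t, HasDerivAt γ (φ t • field α (γ t)) t) (t : ℝ) :
    gap α (γ t) = gap α (γ 0) := by
  refine eq_of_hasDerivAt_zero (g := fun t => gap α (γ t)) (fun t => ?_) t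
  obtain ⟨h1, h2, h3⟩ := hasDerivAt_coords (hγ t)
  refine (((h1.mul (hasDerivAt_conj h1)).const_sub 1).mul ((((h3.mul (hasDerivAt_conj h2)).add
    ((h3.mul (hasDerivAt_conj h3)).mul h1)).mul (((hasDerivAt_conj h3).mul h2).add
    ((h3.mul (hasDerivAt_conj h3)).mul (hasDerivAt_conj h1)))).sub
    ((h3.mul (hasDerivAt_conj h3)).const_mul (α : ℂ)))).congr_deriv ?_
  simp [field, Complex.conj_ofNat]
  ring

end Conservation


/-! ### A priori bounds on level sets -/

/-- The points with the same momentum, mass and gap as `x₀`. -/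
def levelSet (α : ℝ) (x₀ : ℂ × ℂ × ℂ) : Set (ℂ × ℂ × ℂ) :=
  {x | momentum x = momentum x₀ ∧ mass x = mass x₀ ∧ gap α x = gap α x₀}

lemma momentum_eq_norm (x : ℂ × ℂ × ℂ) : momentum x = ((‖x.2.2‖ ^ 2 : ℝ) : ℂ) := by
  rw [momentum, Complex.mul_conj, Complex.normSq_eq_norm_sq]

lemma mass_eq_norm (x : ℂ × ℂ × ℂ) :
    mass x = ((‖x.2.1‖ ^ 2 + ‖x.2.2‖ ^ 2 * (1 - ‖x.1‖ ^ 2) : ℝ) : ℂ) := by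
  simp only [mass, Complex.mul_conj, Complex.normSq_eq_norm_sq]
  push_cast
  ring

lemma gap_eq_norm (α : ℝ) (x : ℂ × ℂ × ℂ) :
    gap α x = (((1 - ‖x.1‖ ^ 2) *
      (‖x.2.2 * conj x.2.1 + ‖x.2.2‖ ^ 2 * x.1‖ ^ 2 - α * ‖x.2.2‖ ^ 2) : ℝ) : ℂ) := by
  have h : ((‖x.2.2 * conj x.2.1 + ‖x.2.2‖ ^ 2 * x.1‖ ^ 2 : ℝ) : ℂ)
      = (x.2.2 * conj x.2.1 + x.2.2 * conj x.2.2 * x.1)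
        * (conj x.2.2 * x.2.1 + x.2.2 * conj x.2.2 * conj x.1) := by
    rw [← Complex.normSq_eq_norm_sq, Complex.normSq_eq_conj_mul_self]
    simp only [Complex.mul_conj, Complex.normSq_eq_norm_sq]
    simp only [map_add, map_mul, Complex.conj_conj, map_pow, Complex.conj_ofReal]
    push_cast
    ring
  rw [gap, ← h]
  simp only [Complex.mul_conj, Complex.normSq_eq_norm_sq]
  push_cast
  ring

/-- In the gap 1 - |p|² multiplies a factor that is at least -α|η|² > 0. Equality of gaps therefore
bounds 1 - |p|² from below once that factor is bounded from above, which mass and momentum provide.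
This is where α < 0 enters. -/
lemma bounds_of_mem_levelSet {α : ℝ} (hα : α < 0) {x₀ x : ℂ × ℂ × ℂ} (hp : ‖x₀.1‖ < 1)
    (he : x₀.2.2 ≠ 0) (hx : x ∈ levelSet α x₀) :
    ‖x.1‖ < 1 ∧ ‖x.2.2‖ = ‖x₀.2.2‖ ∧ ‖x.2.1‖ ^ 2 ≤ ‖x₀.2.1‖ ^ 2 + ‖x₀.2.2‖ ^ 2 ∧
      -α * (1 - ‖x₀.1‖ ^ 2) ≤
        (1 - ‖x.1‖ ^ 2) * (2 * ‖x₀.2.1‖ ^ 2 + 4 * ‖x₀.2.2‖ ^ 2 - α) := by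
  obtain ⟨h1, h2, h3⟩ := hx
  rw [momentum_eq_norm, momentum_eq_norm, Complex.ofReal_inj] at h1
  rw [mass_eq_norm, mass_eq_norm, Complex.ofReal_inj] at h2
  rw [gap_eq_norm, gap_eq_norm, Complex.ofReal_inj] at h3
  have he' : ‖x.2.2‖ = ‖x₀.2.2‖ := (sq_eq_sq₀ (norm_nonneg _) (norm_nonneg _)).mp h1
  have hm : 0 < ‖x₀.2.2‖ := norm_pos_iff.mpr he
  have hr0 : 0 < 1 - ‖x₀.1‖ ^ 2 := by
    have := norm_nonneg x₀.1
    nlinarith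
  rw [h1] at h2 h3
  rw [he'] at h3
  set m := ‖x₀.2.2‖
  have hm2 : 0 < m ^ 2 := by positivity
  have hn : ‖x.2.2 * conj x.2.1 + m ^ 2 * x.1‖ ≤ m * ‖x.2.1‖ + m ^ 2 * ‖x.1‖ := by
    refine (norm_add_le _ _).trans ?_
    rw [norm_mul, norm_mul, he', RCLike.norm_conj, norm_pow, Complex.norm_real, norm_norm]
  set N := ‖x.2.2 * conj x.2.1 + m ^ 2 * x.1‖ with hN
  have hN0 : 0 ≤ N := norm_nonneg _
  set N₀ := ‖x₀.2.2 * conj x₀.2.1 + m ^ 2 * x₀.1‖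
  have hαm : 0 < -α * m ^ 2 := mul_pos (neg_pos.mpr hα) hm2
  have hgap : -α * m ^ 2 * (1 - ‖x₀.1‖ ^ 2) ≤ (1 - ‖x.1‖ ^ 2) * (N ^ 2 - α * m ^ 2) := by
    rw [h3]
    nlinarith [mul_nonneg hr0.le (sq_nonneg N₀)]
  have hpos : 0 < N ^ 2 - α * m ^ 2 := by nlinarith [sq_nonneg N]
  -- The sign comes from the level set alone: the product and its second factor are positive. No
  -- continuity argument along a trajectory is needed to keep p inside the disc.
  have hr : 0 < 1 - ‖x.1‖ ^ 2 := by
    refine pos_of_mul_pos_left (lt_of_lt_of_le ?_ hgap) hpos.le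
    exact mul_pos hαm hr0
  have hp1 : ‖x.1‖ < 1 := by
    have := norm_nonneg x.1
    nlinarith
  have hb : ‖x.2.1‖ ^ 2 ≤ ‖x₀.2.1‖ ^ 2 + m ^ 2 := by
    nlinarith [mul_pos hm2 hr, mul_nonneg hm2.le (sq_nonneg ‖x₀.1‖)]
  refine ⟨hp1, he', hb, ?_⟩
  have hN1 : N ≤ m * (‖x.2.1‖ + m) := by
    refine hn.trans ?_
    nlinarith
  -- The constants come from (|b| + m)² ≤ 2|b|² + 2m² and |b|² ≤ |b₀|² + m².
  have hN2 : N ^ 2 ≤ m ^ 2 * (2 * ‖x₀.2.1‖ ^ 2 + 4 * m ^ 2) := by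
    calc N ^ 2 ≤ (m * (‖x.2.1‖ + m)) ^ 2 := pow_le_pow_left₀ hN0 hN1 2
      _ = m ^ 2 * (‖x.2.1‖ + m) ^ 2 := by ring
      _ ≤ m ^ 2 * (2 * ‖x₀.2.1‖ ^ 2 + 4 * m ^ 2) := by
          refine mul_le_mul_of_nonneg_left ?_ hm2.le
          nlinarith [sq_nonneg (‖x.2.1‖ - m)]
  have hfin : m ^ 2 * (-α * (1 - ‖x₀.1‖ ^ 2)) ≤
      m ^ 2 * ((1 - ‖x.1‖ ^ 2) * (2 * ‖x₀.2.1‖ ^ 2 + 4 * m ^ 2 - α)) := by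
    calc m ^ 2 * (-α * (1 - ‖x₀.1‖ ^ 2)) = -α * m ^ 2 * (1 - ‖x₀.1‖ ^ 2) := by ring
      _ ≤ (1 - ‖x.1‖ ^ 2) * (N ^ 2 - α * m ^ 2) := hgap
      _ ≤ (1 - ‖x.1‖ ^ 2) * (m ^ 2 * (2 * ‖x₀.2.1‖ ^ 2 + 4 * m ^ 2) - α * m ^ 2) :=
          mul_le_mul_of_nonneg_left (by linarith) hr.le
      _ = _ := by ring
  exact le_of_mul_le_mul_left hfin hm2

lemma isCompact_levelSet {α : ℝ} (hα : α < 0) {x₀ : ℂ × ℂ × ℂ} (hp : ‖x₀.1‖ < 1)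
    (he : x₀.2.2 ≠ 0) : IsCompact (levelSet α x₀) := by
  have h1 : Continuous momentum := by unfold momentum; fun_prop
  have h2 : Continuous mass := by unfold mass; fun_prop
  have h3 : Continuous (gap α) := by unfold gap; fun_prop
  refine Metric.isCompact_of_isClosed_isBounded ?_ ?_
  · exact (isClosed_eq h1 continuous_const).inter
      ((isClosed_eq h2 continuous_const).inter (isClosed_eq h3 continuous_const))
  · refine (Metric.isBounded_closedBall (x := (0 : ℂ × ℂ × ℂ))
      (r := 1 + ‖x₀.2.1‖ + ‖x₀.2.2‖)).subset fun x hx => ?_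
    obtain ⟨hp1, he1, hb, -⟩ := bounds_of_mem_levelSet hα hp he hx
    have hb' : ‖x.2.1‖ ≤ ‖x₀.2.1‖ + ‖x₀.2.2‖ := by
      refine abs_le_of_sq_le_sq' ?_ (by positivity) |>.2
      nlinarith [mul_nonneg (norm_nonneg x₀.2.1) (norm_nonneg x₀.2.2)]
    have h4 := norm_nonneg x₀.2.1
    have h5 := norm_nonneg x₀.2.2
    rw [mem_closedBall_zero_iff, Prod.norm_def, Prod.norm_def]
    refine max_le (by linarith) (max_le (by linarith) (by linarith))

/-- A global trajectory exists through every point with `|p| < 1` and `η ≠ 0`. -/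
theorem exists_trajectory {α : ℝ} (hα : α < 0) {x₀ : ℂ × ℂ × ℂ} (hp : ‖x₀.1‖ < 1)
    (he : x₀.2.2 ≠ 0) :
    ∃ γ : ℝ → ℂ × ℂ × ℂ, γ 0 = x₀ ∧ (∀ t, HasDerivAt γ (field α (γ t)) t) ∧
      ∀ t, γ t ∈ levelSet α x₀ := by
  refine exists_integralCurve_of_invariant_compact (contDiff_field α)
    (isCompact_levelSet hα hp he) fun φ γ hγ0 hγ t => ?_
  rw [← hγ0]
  exact ⟨momentum_conserved hγ t, mass_conserved hγ t, gap_conserved hγ t⟩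

/-- Trajectories stay away from `|p| = 1`, uniformly for initial data in bounded sets that stay
away from `|p| = 1`. -/
lemma exists_uniform_bound {α : ℝ} (hα : α < 0) {ρ : ℝ} (hρ0 : 0 ≤ ρ) (hρ : ρ < 1) (D : ℝ) :
    ∃ r : ℝ, 0 ≤ r ∧ r < 1 ∧ ∀ x₀ x : ℂ × ℂ × ℂ, ‖x₀.1‖ ≤ ρ → x₀.2.2 ≠ 0 →
      ‖x₀.2.1‖ ≤ D → ‖x₀.2.2‖ ≤ D → x ∈ levelSet α x₀ →
      ‖x.1‖ ≤ r ∧ ‖x.2.1‖ ≤ 2 * D ∧ ‖x.2.2‖ ≤ D := by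
  have hden : 0 < 6 * D ^ 2 - α := by nlinarith [sq_nonneg D]
  have hρ2 : 0 < 1 - ρ ^ 2 := by nlinarith
  -- The denominator bounds 2|b₀|² + 4|η₀|² - α, so δ is a uniform lower bound for 1 - |p|².
  set δ := -α * (1 - ρ ^ 2) / (6 * D ^ 2 - α) with hδ
  have hδ0 : 0 < δ := div_pos (mul_pos (neg_pos.mpr hα) hρ2) hden
  refine ⟨√(max 0 (1 - δ)), Real.sqrt_nonneg _, ?_, ?_⟩
  · rw [Real.sqrt_lt' one_pos, one_pow]
    exact max_lt one_pos (by linarith)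
  · intro x₀ x hp he hb hm hx
    obtain ⟨hp1, he1, hb1, hk⟩ := bounds_of_mem_levelSet hα (hp.trans_lt hρ) he hx
    have hD : 0 ≤ D := (norm_nonneg _).trans hb
    have hb2 : ‖x₀.2.1‖ ^ 2 ≤ D ^ 2 := pow_le_pow_left₀ (norm_nonneg _) hb 2
    have hm2 : ‖x₀.2.2‖ ^ 2 ≤ D ^ 2 := pow_le_pow_left₀ (norm_nonneg _) hm 2
    have hp2 : ‖x₀.1‖ ^ 2 ≤ ρ ^ 2 := pow_le_pow_left₀ (norm_nonneg _) hp 2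
    have hr : 0 < 1 - ‖x.1‖ ^ 2 := by
      have := norm_nonneg x.1
      nlinarith
    refine ⟨?_, ?_, he1.le.trans hm⟩
    · refine Real.le_sqrt_of_sq_le (le_max_of_le_right ?_)
      have : δ ≤ 1 - ‖x.1‖ ^ 2 := by
        rw [hδ, div_le_iff₀ hden]
        calc -α * (1 - ρ ^ 2) ≤ -α * (1 - ‖x₀.1‖ ^ 2) :=
              mul_le_mul_of_nonneg_left (by linarith) (by linarith)
          _ ≤ _ := hk
          _ ≤ _ := mul_le_mul_of_nonneg_left (by linarith) hr.le
      linarith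
    · refine abs_le_of_sq_le_sq' ?_ (by positivity) |>.2
      nlinarith [sq_nonneg D]

/-! ### Rational functions with one simple pole -/

/-- A continuous function on the circle as an element of `L²`. -/
def contToL2 : C(Circ, ℂ) →L[ℂ] L2 := ContinuousMap.toLp 2 circMeasure ℂ

lemma contToL2_coeFn (f : C(Circ, ℂ)) : (contToL2 f : Circ → ℂ) =ᵐ[circMeasure] f :=
  ContinuousMap.coeFn_toLp circMeasure f

lemma coeff_contToL2 (f : C(Circ, ℂ)) (k : ℤ) : fourierCoeff (contToL2 f) k = fourierCoeff f k :=
  fourierCoeff_toLp f k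

lemma coeff_cont_add (f g : C(Circ, ℂ)) (k : ℤ) :
    fourierCoeff (f + g : C(Circ, ℂ)) k = fourierCoeff f k + fourierCoeff g k := by
  rw [← coeff_contToL2, map_add, coeff_add, coeff_contToL2, coeff_contToL2]

lemma coeff_cont_smul (c : ℂ) (f : C(Circ, ℂ)) (k : ℤ) :
    fourierCoeff (c • f : C(Circ, ℂ)) k = c * fourierCoeff f k := by
  rw [← coeff_contToL2, map_smul, coeff_smul, coeff_contToL2]

lemma coeff_cont_shift (f : C(Circ, ℂ)) (n k : ℤ) :
    fourierCoeff (fourier n * f : C(Circ, ℂ)) k = fourierCoeff f (k - n) :=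
  coeff_fourier_mul n k f

lemma fourier_zero_eq_one : (fourier 0 : C(Circ, ℂ)) = 1 := by
  ext x
  exact fourier_zero

lemma coeff_one (k : ℤ) : fourierCoeff (1 : C(Circ, ℂ)) k = if k = 0 then 1 else 0 := by
  rw [← fourier_zero_eq_one, fourierCoeff_fourier, Pi.single_apply]

lemma coeff_sub (f g : L2) (k : ℤ) :
    fourierCoeff (f - g : L2) k = fourierCoeff f k - fourierCoeff g k := by
  rw [← fourierBasis_repr, ← fourierBasis_repr, ← fourierBasis_repr, map_sub]; rfl

lemma norm_coeff_le (f : L2) (k : ℤ) : ‖fourierCoeff f k‖ ≤ ‖f‖ := by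
  rw [← norm_coeffSeq f]
  exact lp.norm_apply_le_norm two_ne_zero (coeffSeq f) k

/-- The function `1 / (1 - p z)`. -/
def resolv (p : ℂ) : C(Circ, ℂ) := Ring.inverse (1 - p • fourier 1)

lemma norm_smul_fourier (p : ℂ) : ‖p • (fourier 1 : C(Circ, ℂ))‖ = ‖p‖ := by
  rw [norm_smul, fourier_norm, mul_one]

lemma isUnit_one_sub {p : ℂ} (hp : ‖p‖ < 1) : IsUnit (1 - p • fourier 1 : C(Circ, ℂ)) :=
  isUnit_one_sub_of_norm_lt_one (by rwa [norm_smul_fourier])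

lemma one_sub_mul_resolv {p : ℂ} (hp : ‖p‖ < 1) :
    (1 - p • fourier 1 : C(Circ, ℂ)) * resolv p = 1 :=
  Ring.mul_inverse_cancel _ (isUnit_one_sub hp)

lemma one_sub_mul_resolv_apply {p : ℂ} (hp : ‖p‖ < 1) (x : Circ) :
    (1 - p * zFun x) * resolv p x = 1 :=
  DFunLike.congr_fun (one_sub_mul_resolv hp) x

lemma norm_zFun (x : Circ) : ‖zFun x‖ = 1 := by
  rw [zFun, fourier_apply, Circle.norm_coe]

lemma one_sub_ne_zero {p : ℂ} (hp : ‖p‖ < 1) (x : Circ) : 1 - p * zFun x ≠ 0 :=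
  left_ne_zero_of_mul_eq_one (one_sub_mul_resolv_apply hp x)

lemma resolv_apply {p : ℂ} (hp : ‖p‖ < 1) (x : Circ) : resolv p x = (1 - p * zFun x)⁻¹ :=
  eq_inv_of_mul_eq_one_right (one_sub_mul_resolv_apply hp x)

lemma resolv_eq {p : ℂ} (hp : ‖p‖ < 1) :
    resolv p = 1 + p • (fourier 1 * resolv p) := by
  have h := one_sub_mul_resolv hp
  rw [sub_mul, one_mul, smul_mul_assoc] at h
  exact eq_add_of_sub_eq h

/-- The Fourier coefficients of `1 / (1 - p z)`. -/
def geoCoeff (p : ℂ) (k : ℤ) : ℂ := if 0 ≤ k then p ^ k.toNat else 0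

/-- At negative orders the equation reads f̂(k) = p f̂(k - 1). Iterating gives f̂(k) = pⁿ f̂(k - n),
which tends to zero because the coefficients of f are bounded. -/
lemma coeff_neg_of_eq_add {p : ℂ} (hp : ‖p‖ < 1) {f g : C(Circ, ℂ)}
    (hfg : f = g + p • (fourier 1 * f)) (hg : ∀ k : ℤ, k < 0 → fourierCoeff g k = 0) {k : ℤ}
    (hk : k < 0) : fourierCoeff f k = 0 := by
  have hpow : ∀ n : ℕ, fourierCoeff f k = p ^ n * fourierCoeff f (k - n) := by
    intro n
    induction n with
    | zero => simp
    | succ n ih =>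
      have hrec : fourierCoeff f (k - n) = p * fourierCoeff f (k - n - 1) := by
        conv_lhs => rw [hfg]
        rw [coeff_cont_add, coeff_cont_smul, coeff_cont_shift, hg _ (by omega), zero_add]
      rw [ih, hrec]
      push_cast
      rw [pow_succ, mul_assoc, sub_sub]
  have hle : ∀ n : ℕ, ‖fourierCoeff f k‖ ≤ ‖p‖ ^ n * ‖contToL2 f‖ := by
    intro n
    rw [hpow n, norm_mul, norm_pow, ← coeff_contToL2]
    exact mul_le_mul_of_nonneg_left (norm_coeff_le _ _) (by positivity)
  have hlim : Tendsto (fun n : ℕ => ‖p‖ ^ n * ‖contToL2 f‖) atTop (𝓝 0) := by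
    simpa using (tendsto_pow_atTop_nhds_zero_of_lt_one (norm_nonneg p) hp).mul_const
      ‖contToL2 f‖
  exact norm_le_zero_iff.mp (ge_of_tendsto' hlim hle)

lemma coeff_resolv {p : ℂ} (hp : ‖p‖ < 1) (k : ℤ) :
    fourierCoeff (resolv p) k = geoCoeff p k := by
  have hrec : ∀ k : ℤ, fourierCoeff (resolv p) k
      = (if k = 0 then 1 else 0) + p * fourierCoeff (resolv p) (k - 1) := by
    intro k
    conv_lhs => rw [resolv_eq hp]
    rw [coeff_cont_add, coeff_cont_smul, coeff_cont_shift, coeff_one]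
  have hneg : ∀ k : ℤ, k < 0 → fourierCoeff (resolv p) k = 0 := fun k hk =>
    coeff_neg_of_eq_add hp (resolv_eq hp) (fun j hj => by rw [coeff_one, if_neg hj.ne]) hk
  unfold geoCoeff
  split_ifs with hk
  · obtain ⟨n, rfl⟩ := Int.eq_ofNat_of_zero_le hk
    rw [Int.toNat_natCast]
    induction n with
    | zero =>
      rw [hrec, hneg _ (by simp)]
      simp
    | succ n ih =>
      rw [hrec, if_neg (by omega), zero_add, pow_succ']
      have : ((n + 1 : ℕ) : ℤ) - 1 = n := by push_cast; ring
      rw [this, ih (by omega)]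
  · exact hneg k (by omega)

/-- The function `b + c z / (1 - p z)`. -/
def ratFun (p b c : ℂ) : C(Circ, ℂ) := b • 1 + c • (fourier 1 * resolv p)

/-- The Fourier coefficients of `b + c z / (1 - p z)`. -/
def ratCoeff (p b c : ℂ) (k : ℤ) : ℂ := b * (if k = 0 then 1 else 0) + c * geoCoeff p (k - 1)

lemma coeff_ratFun {p : ℂ} (hp : ‖p‖ < 1) (b c : ℂ) (k : ℤ) :
    fourierCoeff (ratFun p b c) k = ratCoeff p b c k := by
  rw [ratFun, coeff_cont_add, coeff_cont_smul, coeff_cont_smul, coeff_cont_shift, coeff_one,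
    coeff_resolv hp, ratCoeff]

lemma ratFun_apply {p : ℂ} (hp : ‖p‖ < 1) (b c : ℂ) (x : Circ) :
    ratFun p b c x = ((c - b * p) * zFun x + b) / (1 - p * zFun x) := by
  have h := one_sub_ne_zero hp x
  change b * 1 + c * (zFun x * resolv p x) = _
  rw [resolv_apply hp, eq_div_iff h]
  linear_combination c * zFun x * inv_mul_cancel₀ h

lemma ratCoeff_neg (p b c : ℂ) {k : ℤ} (hk : k < 0) : ratCoeff p b c k = 0 := by
  rw [ratCoeff, geoCoeff, if_neg (by omega), if_neg (by omega)]
  simp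

lemma ratCoeff_zero (p b c : ℂ) : ratCoeff p b c 0 = b := by
  simp [ratCoeff, geoCoeff]

lemma ratCoeff_succ (p b c : ℂ) (n : ℕ) : ratCoeff p b c (n + 1) = c * p ^ n := by
  rw [ratCoeff, geoCoeff, if_neg (by omega), add_sub_cancel_right, if_pos (by omega)]
  simp

/-- The coefficient c pⁿ sits at order n + 1; the division by r compensates for this shift. -/
lemma norm_ratCoeff_le {p b c : ℂ} {r D : ℝ} (hr : 0 < r) (hr1 : r < 1) (hp : ‖p‖ ≤ r)
    (hb : ‖b‖ ≤ D) (hc : ‖c‖ ≤ D) (k : ℤ) : ‖ratCoeff p b c k‖ ≤ D / r * r ^ k.natAbs := by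
  have hD : 0 ≤ D := (norm_nonneg _).trans hb
  rcases lt_trichotomy k 0 with hk | rfl | hk
  · rw [ratCoeff_neg p b c hk, norm_zero]
    positivity
  · rw [ratCoeff_zero, Int.natAbs_zero, pow_zero, mul_one, le_div_iff₀ hr]
    nlinarith
  · obtain ⟨n, rfl⟩ : ∃ n : ℕ, k = n + 1 := ⟨(k - 1).toNat, by omega⟩
    rw [ratCoeff_succ, norm_mul, norm_pow]
    have : ((n : ℤ) + 1).natAbs = n + 1 := by omega
    rw [this, pow_succ, mul_comm (r ^ n), ← mul_assoc, div_mul_cancel₀ _ hr.ne']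
    exact mul_le_mul hc (pow_le_pow_left₀ (norm_nonneg _) hp n) (by positivity) hD

/-! ### Sobolev norms of the rational functions -/

lemma summable_weight_mul_pow (s : ℝ) {r : ℝ} (hr : 0 ≤ r) (hr1 : r < 1) :
    Summable fun k : ℤ => (1 + (k : ℝ) ^ 2) ^ s * r ^ k.natAbs := by
  have hnat : Summable fun n : ℕ => (1 + (n : ℝ) ^ 2) ^ s * r ^ n := by
    obtain ⟨m, hm⟩ := exists_nat_ge s
    rcases hr.eq_or_lt with rfl | hr0
    · refine summable_of_ne_finset_zero (s := {0}) fun n hn => ?_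
      rw [zero_pow (by simpa using hn), mul_zero]
    have h1 : Summable fun n : ℕ => ((n + 1 : ℕ) : ℝ) ^ (2 * m) * r ^ (n + 1) :=
      (summable_nat_add_iff (f := fun n : ℕ => (n : ℝ) ^ (2 * m) * r ^ n) 1).mpr
        (summable_pow_mul_geometric_of_norm_lt_one (2 * m) (by rwa [Real.norm_of_nonneg hr]))
    refine Summable.of_nonneg_of_le (fun n => by positivity) (fun n => ?_) (h1.mul_left r⁻¹)
    have h2 : (1 + (n : ℝ) ^ 2) ^ s ≤ (((n + 1 : ℕ) : ℝ)) ^ (2 * m) := by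
      calc (1 + (n : ℝ) ^ 2) ^ s ≤ (1 + (n : ℝ) ^ 2) ^ (m : ℝ) :=
            Real.rpow_le_rpow_of_exponent_le (by nlinarith [sq_nonneg (n : ℝ)]) hm
        _ = (1 + (n : ℝ) ^ 2) ^ m := Real.rpow_natCast _ _
        _ ≤ (((n + 1 : ℕ) : ℝ) ^ 2) ^ m := by
            refine pow_le_pow_left₀ (by positivity) ?_ m
            push_cast
            nlinarith [n.cast_nonneg (α := ℝ)]
        _ = _ := (pow_mul _ 2 m).symm
    calc (1 + (n : ℝ) ^ 2) ^ s * r ^ n ≤ ((n + 1 : ℕ) : ℝ) ^ (2 * m) * r ^ n :=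
          mul_le_mul_of_nonneg_right h2 (by positivity)
      _ = r⁻¹ * (((n + 1 : ℕ) : ℝ) ^ (2 * m) * r ^ (n + 1)) := by
          field_simp
          exact (pow_succ r n).symm
  refine Summable.of_nat_of_neg ?_ ?_ <;> simpa using hnat

/-- A majorant of the squared `H^s` norm of `b + c z / (1 - p z)`. -/
def sobolevMaj (s r D : ℝ) (k : ℤ) : ℝ := (1 + (k : ℝ) ^ 2) ^ s * (D / r * r ^ k.natAbs) ^ 2

lemma summable_sobolevMaj (s : ℝ) {r : ℝ} (hr : 0 ≤ r) (hr1 : r < 1) (D : ℝ) :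
    Summable (sobolevMaj s r D) := by
  have h := (summable_weight_mul_pow s (sq_nonneg r) (by nlinarith)).mul_left ((D / r) ^ 2)
  refine h.congr fun k => ?_
  rw [sobolevMaj, mul_pow, ← pow_mul, ← pow_mul, mul_comm 2]
  ring

lemma norm_weightedCoeff_sq (s : ℝ) (f : L2) (k : ℤ) :
    ‖weightedCoeff s f k‖ ^ 2 = (1 + (k : ℝ) ^ 2) ^ s * ‖fourierCoeff f k‖ ^ 2 := by
  have hp : (0 : ℝ) < 1 + (k : ℝ) ^ 2 := by positivity
  rw [weightedCoeff, norm_mul, mul_pow, Complex.norm_real, Real.norm_eq_abs, sq_abs,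
    ← Real.rpow_natCast, ← Real.rpow_mul hp.le]
  simp

/-- The function `b + c z / (1 - p z)` as an element of `H^s₊`. -/
def ratSobolev (s : ℝ) (p b c : ℂ) (hp : ‖p‖ < 1) : HPlus s :=
  ⟨contToL2 (ratFun p b c), by
    have hc : ∀ k, fourierCoeff (contToL2 (ratFun p b c)) k = ratCoeff p b c k := fun k => by
      rw [coeff_contToL2, coeff_ratFun hp]
    refine ⟨fun k hk => ?_, ?_⟩
    · rw [hc, ratCoeff_neg p b c hk]
    · rw [memℓp_gen_iff (by norm_num)]
      simp only [ENNReal.toReal_ofNat, Real.rpow_ofNat]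
      obtain ⟨r, hpr, hr1⟩ := exists_between hp
      have hr : 0 < r := (norm_nonneg p).trans_lt hpr
      refine Summable.of_nonneg_of_le (fun k => by positivity) (fun k => ?_)
        (summable_sobolevMaj s hr.le hr1 (max ‖b‖ ‖c‖))
      rw [norm_weightedCoeff_sq, hc, sobolevMaj]
      exact mul_le_mul_of_nonneg_left (pow_le_pow_left₀ (norm_nonneg _)
        (norm_ratCoeff_le hr hr1 hpr.le (le_max_left _ _) (le_max_right _ _) k) 2)
        (by positivity)⟩

lemma ratSobolev_toL2 (s : ℝ) {p : ℂ} (b c : ℂ) (hp : ‖p‖ < 1) :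
    (ratSobolev s p b c hp).toL2 = contToL2 (ratFun p b c) := rfl

lemma coeff_ratSobolev (s : ℝ) {p : ℂ} (b c : ℂ) (hp : ‖p‖ < 1) (k : ℤ) :
    fourierCoeff (ratSobolev s p b c hp).toL2 k = ratCoeff p b c k := by
  rw [ratSobolev_toL2, coeff_contToL2, coeff_ratFun hp]

/-- Uniform bounds for the `H^s` norms of `b + c z / (1 - p z)`. -/
lemma exists_sobolevNormLT (s : ℝ) {r : ℝ} (hr1 : r < 1) (D : ℝ) :
    ∃ C : ℝ, ∀ p b c : ℂ, ‖p‖ ≤ r → ‖b‖ ≤ D → ‖c‖ ≤ D →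
      SobolevNormLT s (contToL2 (ratFun p b c)) C := by
  -- The majorant divides by the radius, which must therefore be positive.
  set r' := max r (1 / 2)
  have hr' : 0 < r' := lt_max_of_lt_right (by norm_num)
  have hr1' : r' < 1 := max_lt hr1 (by norm_num)
  refine ⟨√(∑' k, sobolevMaj s r' D k) + 1, fun p b c hp hb hc => ?_⟩
  have hp1 : ‖p‖ < 1 := hp.trans_lt hr1
  refine ⟨ratSobolev s p b c hp1, rfl, ?_⟩
  have h : ‖ratSobolev s p b c hp1‖ ≤ √(∑' k, sobolevMaj s r' D k) := by
    refine Real.le_sqrt_of_sq_le ?_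
    rw [HPlus.norm_sq]
    have hle : ∀ k : ℤ, (1 + (k : ℝ) ^ 2) ^ s *
        ‖fourierCoeff (ratSobolev s p b c hp1).toL2 k‖ ^ 2 ≤ sobolevMaj s r' D k := fun k => by
      rw [coeff_ratSobolev]
      exact mul_le_mul_of_nonneg_left (pow_le_pow_left₀ (norm_nonneg _)
        (norm_ratCoeff_le hr' hr1' (hp.trans (le_max_left _ _)) hb hc k) 2) (by positivity)
    have hs := summable_sobolevMaj s hr'.le hr1' D
    exact (Summable.of_nonneg_of_le (fun k => by positivity) hle hs).tsum_le_tsum hle hs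
  linarith

lemma continuous_ratCoeff (k : ℤ) :
    Continuous fun x : ℂ × ℂ × ℂ => ratCoeff x.1 x.2.1 x.2.2 k := by
  unfold ratCoeff geoCoeff
  split_ifs <;> fun_prop

/-- `b + c z / (1 - p z)` depends continuously on `p`, `b`, `c` as an element of `H^s₊`. -/
lemma continuous_ratSobolev (s : ℝ) {p b c : ℝ → ℂ} (hp : ∀ t, ‖p t‖ < 1) (hpc : Continuous p)
    (hbc : Continuous b) (hcc : Continuous c) :
    Continuous fun t => ratSobolev s (p t) (b t) (c t) (hp t) := by
  rw [continuous_iff_continuousAt]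
  intro t₀
  obtain ⟨r, hpr, hr1⟩ := exists_between (hp t₀)
  have hr : 0 < r := (norm_nonneg _).trans_lt hpr
  set D := max ‖b t₀‖ ‖c t₀‖ + 1
  have hev : ∀ᶠ t in 𝓝 t₀, ‖p t‖ ≤ r ∧ ‖b t‖ ≤ D ∧ ‖c t‖ ≤ D := by
    have h1 := hpc.norm.continuousAt.eventually_lt_const hpr
    have h2 := hbc.norm.continuousAt.eventually_lt_const
      (show ‖b t₀‖ < D from (le_max_left _ _).trans_lt (lt_add_one _))
    have h3 := hcc.norm.continuousAt.eventually_lt_const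
      (show ‖c t₀‖ < D from (le_max_right _ _).trans_lt (lt_add_one _))
    filter_upwards [h1, h2, h3] with t h1 h2 h3 using ⟨h1.le, h2.le, h3.le⟩
  have hcoeff : ∀ t k, fourierCoeff (ratSobolev s (p t) (b t) (c t) (hp t)
      - ratSobolev s (p t₀) (b t₀) (c t₀) (hp t₀) : HPlus s).toL2 k
      = ratCoeff (p t) (b t) (c t) k - ratCoeff (p t₀) (b t₀) (c t₀) k := by
    intro t k
    rw [← coeff_ratSobolev s (b t) (c t) (hp t), ← coeff_ratSobolev s (b t₀) (c t₀) (hp t₀)]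
    exact coeff_sub _ _ k
  have hlim : Tendsto (fun t => ∑' k : ℤ, (1 + (k : ℝ) ^ 2) ^ s *
      ‖ratCoeff (p t) (b t) (c t) k - ratCoeff (p t₀) (b t₀) (c t₀) k‖ ^ 2) (𝓝 t₀)
      (𝓝 (∑' _ : ℤ, 0)) := by
    -- Near `t₀` both coefficients obey the same geometric bound; squaring twice that bound gives
    -- the factor 4.
    refine tendsto_tsum_of_dominated_convergence
      ((summable_sobolevMaj s hr.le hr1 D).mul_left 4) (fun k => ?_) ?_
    · have hk : Continuous fun t => (1 + (k : ℝ) ^ 2) ^ s *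
          ‖ratCoeff (p t) (b t) (c t) k - ratCoeff (p t₀) (b t₀) (c t₀) k‖ ^ 2 := by
        have := (continuous_ratCoeff k).comp (hpc.prodMk (hbc.prodMk hcc))
        exact continuous_const.mul ((this.sub continuous_const).norm.pow 2)
      simpa using hk.tendsto t₀
    · filter_upwards [hev] with t ht k
      rw [Real.norm_of_nonneg (by positivity), sobolevMaj]
      have h1 := norm_ratCoeff_le hr hr1 ht.1 ht.2.1 ht.2.2 k
      have h2 := norm_ratCoeff_le hr hr1 hev.self_of_nhds.1 hev.self_of_nhds.2.1
        hev.self_of_nhds.2.2 k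
      have h3 := (norm_sub_le (ratCoeff (p t) (b t) (c t) k)
        (ratCoeff (p t₀) (b t₀) (c t₀) k)).trans (add_le_add h1 h2)
      have h4 := pow_le_pow_left₀ (norm_nonneg _) h3 2
      have hw : 0 ≤ (1 + (k : ℝ) ^ 2) ^ s := by positivity
      calc _ ≤ (1 + (k : ℝ) ^ 2) ^ s * (D / r * r ^ k.natAbs + D / r * r ^ k.natAbs) ^ 2 :=
            mul_le_mul_of_nonneg_left h4 hw
        _ = _ := by ring
  rw [tsum_zero] at hlim
  rw [ContinuousAt, tendsto_iff_norm_sub_tendsto_zero]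
  have hsq : Tendsto (fun t => √(‖ratSobolev s (p t) (b t) (c t) (hp t)
      - ratSobolev s (p t₀) (b t₀) (c t₀) (hp t₀)‖ ^ 2)) (𝓝 t₀) (𝓝 0) := by
    rw [← Real.sqrt_zero]
    refine (Real.continuous_sqrt.tendsto 0).comp (hlim.congr fun t => ?_)
    rw [HPlus.norm_sq]
    exact tsum_congr fun k => by rw [hcoeff]
  simpa [Real.sqrt_sq (norm_nonneg _)] using hsq

/-! ### Functions with a shifted Hankel operator of rank one -/

/-- The function `e^{ijx}`, `j ≥ 0`, as an element of `L²₊`. -/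
def hardyMonomial (j : ℕ) : hardy :=
  ⟨contToL2 (fourier j), fun k hk => by
    rw [coeff_contToL2, fourierCoeff_fourier, Pi.single_apply, if_neg (by omega)]⟩

lemma coeff_hankel (u : HPlus (1 / 2)) (h : hardy) {n : ℤ} (hn : 0 ≤ n) :
    fourierCoeff (hankel u h : L2) n
      = fourierCoeff (fun x => u.toL2 x * conj ((h : L2) x)) n := by
  refine (szego_coeff _ (memℓp_hankel u h) n).trans ?_
  rw [posCoeff, if_pos hn]

lemma coeff_shiftAdjoint (h : hardy) {n : ℤ} (hn : 0 ≤ n) :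
    fourierCoeff (shiftAdjoint h : L2) n = fourierCoeff (h : L2) (n + 1) := by
  refine (szego_coeff _ (memℓp_posCoeff_of_memLp (memLp_fourier_mul (-1) (h : L2))) n).trans ?_
  rw [posCoeff, if_pos hn, coeff_fourier_mul, sub_neg_eq_add]

lemma coeff_shiftedHankel (u : HPlus (1 / 2)) (h : hardy) {n : ℤ} (hn : 0 ≤ n) :
    fourierCoeff (shiftedHankel u h : L2) n
      = fourierCoeff (fun x => u.toL2 x * conj ((h : L2) x)) (n + 1) := by
  rw [← coeff_hankel u h (by omega), ← coeff_shiftAdjoint _ hn]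
  rfl

lemma coeff_shiftedHankel_monomial (u : HPlus (1 / 2)) (j : ℕ) {n : ℤ} (hn : 0 ≤ n) :
    fourierCoeff (shiftedHankel u (hardyMonomial j) : L2) n
      = fourierCoeff u.toL2 (n + 1 + j) := by
  rw [coeff_shiftedHankel u _ hn]
  have h : (fun x => u.toL2 x * conj ((hardyMonomial j : L2) x))
      =ᵐ[circMeasure] fun x => fourier (-(j : ℤ)) x * u.toL2 x := by
    filter_upwards [contToL2_coeFn (fourier (j : ℤ))] with x hx
    change u.toL2 x * conj ((contToL2 (fourier (j : ℤ)) : Circ → ℂ) x) = _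
    rw [hx, fourier_neg, mul_comm]
  rw [congrFun (fourierCoeff_congr_ae h) (n + 1), coeff_fourier_mul, sub_neg_eq_add]

/-- Since h̄ has no positive frequencies, the coefficient of u h̄ at order n ≥ 1 involves û(k) only
for k ≥ n. -/
lemma shiftedHankel_eq_zero {u : HPlus (1 / 2)}
    (hu : ∀ n : ℤ, 1 ≤ n → fourierCoeff u.toL2 n = 0) (h : hardy) : shiftedHankel u h = 0 := by
  apply Subtype.ext
  apply ext_coeff
  intro k
  refine Eq.trans ?_ (coeff_zero k).symm
  rcases lt_or_ge k 0 with hk | hk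
  · exact (shiftedHankel u h).2 k hk
  · rw [coeff_shiftedHankel u h hk, ← norm_le_zero_iff]
    have h1 := norm_coeff_mul_conj_sq_le u.toL2 h (show 0 ≤ k + 1 by omega)
    have h2 : ∑' j : ℤ, tail u.toL2 (k + 1) j = 0 := by
      rw [← tsum_zero (α := ℝ) (β := ℤ)]
      refine tsum_congr fun j => ?_
      unfold tail
      split_ifs with hj
      · rw [hu j (by omega)]
        simp
      · rfl
    rw [h2, mul_zero] at h1
    exact (pow_eq_zero_iff two_ne_zero).mp (le_antisymm h1 (sq_nonneg _)) |>.le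

/-- A function in `𝓛(1)` is of the form `b + c z / (1 - p z)` with `|p| < 1` and `c ≠ 0`. -/
lemma exists_params_of_mem_rankSet {u : HPlus (1 / 2)} (hu : u ∈ rankSet 1) :
    ∃ p : ℂ, ‖p‖ < 1 ∧ fourierCoeff u.toL2 1 ≠ 0 ∧
      p = fourierCoeff u.toL2 2 / fourierCoeff u.toL2 1 ∧
      u.toL2 = contToL2 (ratFun p (fourierCoeff u.toL2 0) (fourierCoeff u.toL2 1)) := by
  have hrank : Module.rank ℂ (LinearMap.range (shiftedHankel u)) = 1 := by
    simpa [rankSet] using hu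
  obtain ⟨v, ⟨h, hv⟩, hv0, hle⟩ := (rank_submodule_eq_one_iff _).mp hrank
  have hmem : ∀ j : ℕ, ∃ a : ℂ, a • v = shiftedHankel u (hardyMonomial j) := fun j =>
    Submodule.mem_span_singleton.mp (hle ⟨hardyMonomial j, rfl⟩)
  -- The images of 1 and z are û shifted by one and by two. Both are multiples of the same v, so
  -- these two shifts are proportional, which is the geometric recursion with ratio p = a'/a.
  obtain ⟨a, ha⟩ := hmem 0
  obtain ⟨a', ha'⟩ := hmem 1
  have hcoeff : ∀ n : ℕ, a * fourierCoeff (v : L2) n = fourierCoeff u.toL2 (n + 1) := by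
    intro n
    rw [← coeff_smul, ← Submodule.coe_smul, ha,
      coeff_shiftedHankel_monomial u 0 (Int.natCast_nonneg n)]
    simp
  have hcoeff' : ∀ n : ℕ, a' * fourierCoeff (v : L2) n = fourierCoeff u.toL2 (n + 2) := by
    intro n
    rw [← coeff_smul, ← Submodule.coe_smul, ha',
      coeff_shiftedHankel_monomial u 1 (Int.natCast_nonneg n)]
    congr 1
  have hne : ¬ ∀ n : ℤ, 1 ≤ n → fourierCoeff u.toL2 n = 0 := fun hz =>
    hv0 (hv.symm.trans (shiftedHankel_eq_zero hz h))
  have ha0 : a ≠ 0 := by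
    rintro rfl
    refine hne fun n hn => ?_
    obtain ⟨m, rfl⟩ : ∃ m : ℕ, n = m + 1 := ⟨(n - 1).toNat, by omega⟩
    rw [← hcoeff m, zero_mul]
  set p := a' / a with hp
  set c := fourierCoeff u.toL2 1 with hc
  have hrec : ∀ n : ℕ, fourierCoeff u.toL2 (n + 2) = p * fourierCoeff u.toL2 (n + 1) := by
    intro n
    rw [← hcoeff, ← hcoeff', hp]
    field_simp
  have hpow : ∀ n : ℕ, fourierCoeff u.toL2 (n + 1) = c * p ^ n := by
    intro n
    induction n with
    | zero => simp [hc]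
    | succ n ih =>
      have h1 : ((n + 1 : ℕ) : ℤ) + 1 = n + 2 := by push_cast; ring
      rw [h1, hrec, ih]
      ring
  have hc0 : c ≠ 0 := by
    intro hc0
    refine hne fun n hn => ?_
    obtain ⟨m, rfl⟩ : ∃ m : ℕ, n = m + 1 := ⟨(n - 1).toNat, by omega⟩
    rw [hpow m, hc0, zero_mul]
  -- Square summability of c pⁿ with c ≠ 0 excludes |p| ≥ 1.
  have hp1 : ‖p‖ < 1 := by
    have hs : Summable fun n : ℤ => ‖fourierCoeff u.toL2 n‖ ^ 2 :=
      (hasSum_sq_fourierCoeff u.toL2).summable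
    have hs' : Summable fun n : ℕ => ‖fourierCoeff u.toL2 (n + 1)‖ ^ 2 :=
      hs.comp_injective (i := fun n : ℕ => (n : ℤ) + 1) fun m n hmn => by simpa using hmn
    have hs'' : Summable fun n : ℕ => (‖p‖ ^ 2) ^ n := by
      refine (hs'.mul_left (‖c‖ ^ 2)⁻¹).congr fun n => ?_
      have : ‖c‖ ≠ 0 := norm_ne_zero_iff.mpr hc0
      rw [hpow, norm_mul, norm_pow]
      field_simp
      ring
    have h1 := summable_geometric_iff_norm_lt_one.mp hs''
    rw [Real.norm_of_nonneg (by positivity)] at h1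
    have := norm_nonneg p
    nlinarith
  refine ⟨p, hp1, hc0, ?_, ?_⟩
  · have := hpow 1
    rw [eq_div_iff hc0]
    norm_num at this
    rw [this, mul_comm]
  · apply ext_coeff
    intro k
    rw [coeff_contToL2, coeff_ratFun hp1]
    rcases lt_trichotomy k 0 with hk | rfl | hk
    · rw [ratCoeff_neg _ _ _ hk]
      exact u.2.1 k hk
    · rw [ratCoeff_zero]
    · obtain ⟨n, rfl⟩ : ∃ n : ℕ, k = n + 1 := ⟨(k - 1).toNat, by omega⟩
      rw [ratCoeff_succ, hpow]

lemma continuous_coeff (k : ℤ) :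
    Continuous fun u : HPlus (1 / 2) => fourierCoeff u.toL2 k := by
  have hw : (((1 + (k : ℝ) ^ 2) ^ ((1 / 2 : ℝ) / 2) : ℝ) : ℂ) ≠ 0 := by
    exact_mod_cast (Real.rpow_pos_of_pos (by positivity) _).ne'
  have h1 : LipschitzWith 1 fun u : HPlus (1 / 2) => weightedCoeff (1 / 2) u.toL2 k := by
    refine LipschitzWith.of_dist_le_mul fun u v => ?_
    rw [NNReal.coe_one, one_mul, dist_eq_norm, dist_eq_norm]
    have h := lp.norm_apply_le_norm two_ne_zero (HPlus.toSeq (1 / 2) (u - v)) k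
    have h2 : (HPlus.toSeq (1 / 2) (u - v)) k
        = weightedCoeff (1 / 2) u.toL2 k - weightedCoeff (1 / 2) v.toL2 k := by
      rw [map_sub]
      rfl
    rw [h2] at h
    exact h
  refine (h1.continuous.const_smul
    (((1 + (k : ℝ) ^ 2) ^ ((1 / 2 : ℝ) / 2) : ℝ) : ℂ)⁻¹).congr fun u => ?_
  exact inv_mul_cancel_left₀ hw _

/-- The parameters of the functions in a compact subset of `𝓛(1)` are uniformly bounded. -/
lemma exists_bounds_of_isCompact {K : Set (HPlus (1 / 2))} (hK : K ⊆ rankSet 1)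
    (hc : IsCompact K) :
    ∃ ρ D : ℝ, 0 ≤ ρ ∧ ρ < 1 ∧ ∀ u ∈ K,
      ‖fourierCoeff u.toL2 2 / fourierCoeff u.toL2 1‖ ≤ ρ ∧ ‖fourierCoeff u.toL2 0‖ ≤ D ∧
        ‖fourierCoeff u.toL2 1‖ ≤ D := by
  rcases K.eq_empty_or_nonempty with rfl | hne
  · exact ⟨0, 0, le_rfl, one_pos, by simp⟩
  have hcont : ContinuousOn
      (fun u : HPlus (1 / 2) => ‖fourierCoeff u.toL2 2 / fourierCoeff u.toL2 1‖) K := by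
    refine ((continuous_coeff 2).continuousOn.div (continuous_coeff 1).continuousOn
      fun u hu => ?_).norm
    obtain ⟨p, -, h, -⟩ := exists_params_of_mem_rankSet (hK hu)
    exact h
  -- The maximum of |p| is attained at an element of 𝓛(1), where |p| < 1; this makes ρ strictly less
  -- than 1.
  obtain ⟨u₁, hu₁, hmax⟩ := hc.exists_isMaxOn hne hcont
  obtain ⟨C₀, hC₀⟩ := hc.exists_bound_of_continuousOn (continuous_coeff 0).continuousOn
  obtain ⟨C₁, hC₁⟩ := hc.exists_bound_of_continuousOn (continuous_coeff 1).continuousOn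
  refine ⟨_, max C₀ C₁, norm_nonneg _, ?_, fun u hu => ⟨hmax hu, ?_, ?_⟩⟩
  · obtain ⟨p, hp, -, h, -⟩ := exists_params_of_mem_rankSet (hK hu₁)
    rwa [← h]
  · exact (hC₀ u hu).trans (le_max_left _ _)
  · exact (hC₁ u hu).trans (le_max_right _ _)

/-! ### Trajectories give solutions of the equation -/

/-- Differentiation takes place in the Banach algebra C(𝕊¹), where inversion is differentiable at
units; the derivative then passes to L² through a continuous linear map. -/
lemma hasDerivAt_resolv {p : ℝ → ℂ} {p' : ℂ} {t : ℝ} (hp : ‖p t‖ < 1) (h : HasDerivAt p p' t) :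
    HasDerivAt (fun t => resolv (p t)) (p' • (fourier 1 * (resolv (p t) * resolv (p t)))) t := by
  obtain ⟨v, hv⟩ := isUnit_one_sub hp
  have h1 : HasDerivAt (fun t => (1 - p t • fourier 1 : C(Circ, ℂ))) (-(p' • fourier 1)) t :=
    (h.smul_const (fourier 1 : C(Circ, ℂ))).const_sub 1
  have h2 := hasFDerivAt_ringInverse (𝕜 := ℝ) v
  rw [hv] at h2
  have h3 := h2.comp_hasDerivAt t h1
  have hinv : ((v⁻¹ : (C(Circ, ℂ))ˣ) : C(Circ, ℂ)) = resolv (p t) := by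
    rw [resolv, ← hv, Ring.inverse_unit]
  refine h3.congr_deriv ?_
  rw [hinv]
  simp only [neg_apply, ContinuousLinearMap.mulLeftRight_apply]
  rw [mul_neg, neg_mul, neg_neg, mul_smul_comm, smul_mul_assoc]
  congr 1
  ring

/-- The velocity of `b + c z / (1 - p z)`. -/
def ratVelocity (p c p' b' c' : ℂ) : C(Circ, ℂ) :=
  b' • 1 + c' • (fourier 1 * resolv p)
    + (c * p') • (fourier 1 * (fourier 1 * (resolv p * resolv p)))

lemma hasDerivAt_ratFun {p b c : ℝ → ℂ} {p' b' c' : ℂ} {t : ℝ} (hp : ‖p t‖ < 1)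
    (h1 : HasDerivAt p p' t) (h2 : HasDerivAt b b' t) (h3 : HasDerivAt c c' t) :
    HasDerivAt (fun t => ratFun (p t) (b t) (c t)) (ratVelocity (p t) (c t) p' b' c') t := by
  have h4 := ((hasDerivAt_resolv hp h1).const_mul (fourier 1 : C(Circ, ℂ)))
  refine ((h2.smul_const (1 : C(Circ, ℂ))).add (h3.smul h4)).congr_deriv ?_
  rw [ratVelocity, mul_smul_comm, smul_smul, add_assoc]
  congr 1
  exact add_comm _ _

lemma hasDerivAt_contToL2 {f : ℝ → C(Circ, ℂ)} {f' : C(Circ, ℂ)} {t : ℝ}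
    (h : HasDerivAt f f' t) : HasDerivAt (fun t => contToL2 (f t)) (contToL2 f') t :=
  ((contToL2.restrictScalars ℝ).hasFDerivAt (x := f t)).comp_hasDerivAt t h

lemma coeff_resolv_mul_resolv_neg {p : ℂ} (hp : ‖p‖ < 1) {k : ℤ} (hk : k < 0) :
    fourierCoeff (resolv p * resolv p : C(Circ, ℂ)) k = 0 := by
  refine coeff_neg_of_eq_add hp (g := resolv p) ?_ (fun j hj => ?_) hk
  · have h := congrArg (· * resolv p) (resolv_eq hp)
    simpa only [add_mul, one_mul, smul_mul_assoc, mul_assoc] using h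
  · rw [coeff_resolv hp, geoCoeff, if_neg (by omega)]

lemma coeff_ratVelocity_neg {p : ℂ} (hp : ‖p‖ < 1) (c p' b' c' : ℂ) {k : ℤ} (hk : k < 0) :
    fourierCoeff (ratVelocity p c p' b' c') k = 0 := by
  rw [ratVelocity, coeff_cont_add, coeff_cont_add, coeff_cont_smul, coeff_cont_smul,
    coeff_cont_smul, coeff_cont_shift, coeff_cont_shift, coeff_cont_shift, coeff_one,
    if_neg hk.ne, coeff_resolv hp, geoCoeff, if_neg (by omega),
    coeff_resolv_mul_resolv_neg hp (by omega)]
  simp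

lemma coeff_star (f : C(Circ, ℂ)) (k : ℤ) :
    fourierCoeff (star f : C(Circ, ℂ)) k = conj (fourierCoeff f (-k)) := by
  unfold fourierCoeff
  rw [← integral_conj]
  refine integral_congr_ae (Eventually.of_forall fun x => ?_)
  simp only [smul_eq_mul, map_mul, ← fourier_neg, neg_neg]
  rfl

/-- The algebraic identity behind the invariance of the family `b + c z / (1 - p z)`. -/
lemma cubic_identity {p b e p' b' e' z α : ℂ} (h1 : 1 - p * z ≠ 0)
    (h2 : z - p' ≠ 0) :
    (b + e * (1 - p * p') * (z * (1 - p * z)⁻¹)) * (b' + e' * (1 - p * p') * (z - p')⁻¹)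
        * (b + e * (1 - p * p') * (z * (1 - p * z)⁻¹)) + α * b
      = ((b * b' + 2 * (e * e') * (1 - p * p') + α) * b + e * e' * e * (1 - p * p') * p')
        + (e * (2 * (b * b') + e * e' + p' * e * b' + p * e' * b) * (1 - p * p')
            - e * (((1 - p * p') * (e * b' + e * e' * p)) * p'
              - p * ((1 - p * p') * (e' * b + e * e' * p')))) * (z * (1 - p * z)⁻¹)
        + e * (1 - p * p') * ((1 - p * p') * (e * b' + e * e' * p))
          * (z * (z * ((1 - p * z)⁻¹ * (1 - p * z)⁻¹)))
        + (1 - p * p') * (e' * b + e * e' * p') * (b + e * p') * (z - p')⁻¹ := by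
  field_simp
  ring


/-- The residue parameter `c = η (1 - |p|²)`. -/
def residue (x : ℂ × ℂ × ℂ) : ℂ := x.2.2 * (1 - x.1 * conj x.1)

/-- The velocity of `c`, up to the factor `-i`. -/
def residueVelocity (x : ℂ × ℂ × ℂ) : ℂ :=
  x.2.2 * (2 * (x.2.1 * conj x.2.1) + x.2.2 * conj x.2.2 + conj x.1 * x.2.2 * conj x.2.1
      + x.1 * conj x.2.2 * x.2.1) * (1 - x.1 * conj x.1)
    - x.2.2 * (((1 - x.1 * conj x.1) * (x.2.2 * conj x.2.1 + x.2.2 * conj x.2.2 * x.1)) * conj x.1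
      - x.1 * ((1 - x.1 * conj x.1) * (conj x.2.2 * x.2.1 + x.2.2 * conj x.2.2 * conj x.1)))

lemma hasDerivAt_residue {α : ℝ} {γ : ℝ → ℂ × ℂ × ℂ} {t : ℝ}
    (hγ : HasDerivAt γ (field α (γ t)) t) :
    HasDerivAt (fun t => residue (γ t)) (-Complex.I * residueVelocity (γ t)) t := by
  obtain ⟨h1, -, h3⟩ := hasDerivAt_coords hγ
  refine (h3.mul ((h1.mul (hasDerivAt_conj h1)).const_sub 1)).congr_deriv ?_
  simp [field, residueVelocity]
  ring

/-- The function `∂ₜu` along a trajectory. -/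
def trajVelocity (α : ℝ) (x : ℂ × ℂ × ℂ) : C(Circ, ℂ) :=
  ratVelocity x.1 (residue x) (field α x).1 (field α x).2.1 (-Complex.I * residueVelocity x)

/-- The function `|u|²u` for `u = b + c z / (1 - p z)`. -/
def cubic (α : ℝ) (x : ℂ × ℂ × ℂ) : C(Circ, ℂ) :=
  Complex.I • trajVelocity α x + (-(α * x.2.1)) • 1
    + ((1 - x.1 * conj x.1) * (conj x.2.2 * x.2.1 + x.2.2 * conj x.2.2 * conj x.1)
      * (x.2.1 + x.2.2 * conj x.1)) • star (fourier 1 * resolv x.1)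

lemma zFun_ne_zero (x : Circ) : zFun x ≠ 0 := by
  rw [← norm_ne_zero_iff, norm_zFun]
  exact one_ne_zero

lemma conj_zFun_mul_resolv {p : ℂ} (hp : ‖p‖ < 1) (y : Circ) :
    conj (zFun y * resolv p y) = (zFun y - conj p)⁻¹ ∧ zFun y - conj p ≠ 0 := by
  have hz := zFun_ne_zero y
  have hc : conj (zFun y) = (zFun y)⁻¹ :=
    (Complex.inv_eq_conj (norm_zFun y)).symm
  have h1 : zFun y - conj p ≠ 0 := by
    have h := (map_ne_zero (starRingEnd ℂ)).mpr (one_sub_ne_zero hp y)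
    rw [map_sub, map_one, map_mul, hc] at h
    intro h0
    apply h
    rw [← sub_eq_zero.mp h0, mul_inv_cancel₀ hz, sub_self]
  refine ⟨?_, h1⟩
  rw [resolv_apply hp, map_mul, map_inv₀, map_sub, map_one, map_mul, hc, ← mul_inv, mul_sub,
    mul_one, mul_left_comm, mul_inv_cancel₀ hz, mul_one]

/-- `cubic` is written in the form in which Π can be read off: i times the velocity, minus αb, plus
a conjugated pole term. On the circle z̄ = 1/z, so conjugation turns z/(1 - pz) into 1/(z - p̄), and
the claim becomes `cubic_identity` with conjugates for the primed variables. -/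
lemma cubic_apply (α : ℝ) {x : ℂ × ℂ × ℂ} (hp : ‖x.1‖ < 1) (y : Circ) :
    (‖ratFun x.1 x.2.1 (residue x) y‖ : ℂ) ^ 2 * ratFun x.1 x.2.1 (residue x) y
      = cubic α x y := by
  obtain ⟨hconj, h2⟩ := conj_zFun_mul_resolv hp y
  have h1 := one_sub_ne_zero hp y
  have hu : ratFun x.1 x.2.1 (residue x) y
      = x.2.1 + x.2.2 * (1 - x.1 * conj x.1) * (zFun y * resolv x.1 y) := by
    change x.2.1 * 1 + _ = _
    rw [mul_one]
    rfl
  have huc : conj (ratFun x.1 x.2.1 (residue x) y)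
      = conj x.2.1 + conj x.2.2 * (1 - x.1 * conj x.1) * (zFun y - conj x.1)⁻¹ := by
    rw [hu, map_add, map_mul, hconj]
    simp only [map_mul, map_sub, map_one, Complex.conj_conj]
    ring
  have hV : cubic α x y = Complex.I * ((field α x).2.1 * 1
      + (-Complex.I * residueVelocity x) * (zFun y * resolv x.1 y)
      + (residue x * (field α x).1) * (zFun y * (zFun y * (resolv x.1 y * resolv x.1 y))))
      + (-(α * x.2.1)) * 1
      + ((1 - x.1 * conj x.1) * (conj x.2.2 * x.2.1 + x.2.2 * conj x.2.2 * conj x.1)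
      * (x.2.1 + x.2.2 * conj x.1)) * conj (zFun y * resolv x.1 y) := rfl
  rw [← Complex.mul_conj', hV, huc, hu, hconj, resolv_apply hp]
  have key := cubic_identity (b := x.2.1) (e := x.2.2) (b' := conj x.2.1) (e' := conj x.2.2)
    (α := α) h1 h2
  -- All velocities carry a factor -i, which cancels the i of the equation.
  have hI : ∀ B C P r s q : ℂ, Complex.I * ((-Complex.I * B) * 1 + (-Complex.I * C) * s
      + (r * (-Complex.I * P)) * q) = B + C * s + r * P * q := fun B C P r s q => by
    linear_combination -(B + C * s + r * P * q) * Complex.I_mul_I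
  simp only [field, residue, residueVelocity, hI]
  linear_combination key

/-- The conjugate of z / (1 - p z) has only strictly negative frequencies and drops out. -/
lemma coeff_cubic (α : ℝ) {x : ℂ × ℂ × ℂ} (hp : ‖x.1‖ < 1) {k : ℤ} (hk : 0 ≤ k) :
    fourierCoeff (cubic α x) k = Complex.I * fourierCoeff (trajVelocity α x) k
      - α * x.2.1 * (if k = 0 then 1 else 0) := by
  rw [cubic, coeff_cont_add, coeff_cont_add, coeff_cont_smul, coeff_cont_smul, coeff_cont_smul,
    coeff_star, coeff_cont_shift, coeff_resolv hp, geoCoeff, if_neg (by omega), coeff_one,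
    map_zero]
  ring

lemma const_eq_contToL2 (a : ℂ) : Lp.const 2 circMeasure a = contToL2 (a • 1) := by
  apply Lp.ext
  filter_upwards [Lp.coeFn_const 2 circMeasure a, contToL2_coeFn (a • 1)] with x h1 h2
  rw [h1, h2]
  simp

lemma integral_eq_coeff_zero (f : Circ → ℂ) : ∫ x, f x ∂circMeasure = fourierCoeff f 0 := by
  simp [fourierCoeff]

/-- A trajectory of the system in coordinates that stays in `|p| < 1` gives a solution of the
equation. -/
theorem isSolution_of_trajectory {α : ℝ} {γ : ℝ → ℂ × ℂ × ℂ}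
    (hγ : ∀ t, HasDerivAt γ (field α (γ t)) t) (hp : ∀ t, ‖(γ t).1‖ < 1) :
    IsSolution α (ratSobolev (1 / 2) (γ 0).1 (γ 0).2.1 (residue (γ 0)) (hp 0))
      fun t => ratSobolev (1 / 2) (γ t).1 (γ t).2.1 (residue (γ t)) (hp t) where
  continuous := by
    have hc : Continuous γ := continuous_iff_continuousAt.mpr fun t => (hγ t).continuousAt
    have hr : Continuous residue := by unfold residue; fun_prop
    exact continuous_ratSobolev _ hp hc.fst hc.snd.fst (hr.comp hc)
  initial := rfl
  equation t := by
    have hae : (fun y => (‖(ratSobolev (1 / 2) (γ t).1 (γ t).2.1 (residue (γ t)) (hp t)).toL2 y‖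
        : ℂ) ^ 2 * (ratSobolev (1 / 2) (γ t).1 (γ t).2.1 (residue (γ t)) (hp t)).toL2 y)
        =ᵐ[circMeasure] cubic α (γ t) := by
      filter_upwards [contToL2_coeFn (ratFun (γ t).1 (γ t).2.1 (residue (γ t)))] with y hy
      rw [ratSobolev_toL2, hy, cubic_apply α (hp t)]
    have hmem : MemLp (cubic α (γ t)) 2 circMeasure :=
      (memLp_congr_ae (contToL2_coeFn (cubic α (γ t)))).mp (Lp.memLp _)
    obtain ⟨h1, h2, -⟩ := hasDerivAt_coords (hγ t)
    refine ⟨(memLp_congr_ae hae).mpr hmem, contToL2 (trajVelocity α (γ t)),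
      hasDerivAt_contToL2 (hasDerivAt_ratFun (hp t) h1 h2 (hasDerivAt_residue (hγ t))), ?_⟩
    rw [integral_eq_coeff_zero, const_eq_contToL2, coeff_ratSobolev, ratCoeff_zero]
    apply ext_coeff
    intro k
    rw [coeff_smul, coeff_add, coeff_contToL2, coeff_contToL2, szego_coeff, coeff_cont_smul,
      coeff_one, posCoeff, congrFun (fourierCoeff_congr_ae hae) k]
    split_ifs with hk hk0 hk0
    · rw [coeff_cubic α (hp t) hk, if_pos hk0]
      ring
    · rw [coeff_cubic α (hp t) hk, if_neg hk0]
      ring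
    · omega
    · rw [trajVelocity, coeff_ratVelocity_neg (hp t) _ _ _ _ (by omega)]
      ring

/-! ### Estimates in `H^{1/2}₊` -/

lemma tsum_nat_eq_tsum_int {f : ℤ → ℝ} (hf : ∀ k < 0, f k = 0) :
    ∑' n : ℕ, f n = ∑' k : ℤ, f k := by
  refine Function.Injective.tsum_eq (g := fun n : ℕ => (n : ℤ)) Nat.cast_injective fun k hk => ?_
  have : 0 ≤ k := not_lt.mp fun h => hk (hf k h)
  exact ⟨k.toNat, by simp [this]⟩

/-- The quantity `∑ (1 + k) |ŵ(k)|²`, equivalent to the square of the `H^{1/2}` norm. -/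
def halfEnergy (w : HPlus (1 / 2)) : ℝ := ∑' k : ℕ, (1 + (k : ℝ)) * ‖fourierCoeff w.toL2 k‖ ^ 2

lemma one_add_le_two_mul_rpow (k : ℕ) : 1 + (k : ℝ) ≤ 2 * (1 + (k : ℝ) ^ 2) ^ (1 / 2 : ℝ) := by
  rw [← Real.sqrt_eq_rpow]
  have h1 : (k : ℝ) ≤ √(1 + (k : ℝ) ^ 2) := Real.le_sqrt_of_sq_le (by linarith)
  have h2 : 1 ≤ √(1 + (k : ℝ) ^ 2) := Real.one_le_sqrt.mpr (by nlinarith [sq_nonneg (k : ℝ)])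
  linarith

lemma summable_sobolev (w : HPlus (1 / 2)) :
    Summable fun k : ℤ => (1 + (k : ℝ) ^ 2) ^ (1 / 2 : ℝ) * ‖fourierCoeff w.toL2 k‖ ^ 2 := by
  have h := w.2.2
  rw [memℓp_gen_iff (by norm_num)] at h
  simp only [ENNReal.toReal_ofNat, Real.rpow_ofNat] at h
  exact h.congr fun k => norm_weightedCoeff_sq _ _ k

lemma halfEnergy_term_le (w : HPlus (1 / 2)) (k : ℕ) :
    (1 + (k : ℝ)) * ‖fourierCoeff w.toL2 k‖ ^ 2 ≤
      2 * ((1 + (((k : ℤ) : ℝ)) ^ 2) ^ (1 / 2 : ℝ) * ‖fourierCoeff w.toL2 k‖ ^ 2) := by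
  rw [← mul_assoc]
  refine mul_le_mul_of_nonneg_right ?_ (by positivity)
  simpa using one_add_le_two_mul_rpow k

lemma summable_halfEnergy (w : HPlus (1 / 2)) :
    Summable fun k : ℕ => (1 + (k : ℝ)) * ‖fourierCoeff w.toL2 k‖ ^ 2 :=
  Summable.of_nonneg_of_le (fun k => by positivity) (halfEnergy_term_le w)
    (((summable_sobolev w).comp_injective Nat.cast_injective).mul_left 2)

lemma halfEnergy_nonneg (w : HPlus (1 / 2)) : 0 ≤ halfEnergy w :=
  tsum_nonneg fun k => by positivity

lemma halfEnergy_le (w : HPlus (1 / 2)) : halfEnergy w ≤ 2 * ‖w‖ ^ 2 := by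
  have h1 := (summable_sobolev w).comp_injective (Nat.cast_injective (R := ℤ))
  refine ((summable_halfEnergy w).tsum_le_tsum (halfEnergy_term_le w) (h1.mul_left 2)).trans ?_
  rw [tsum_mul_left, HPlus.norm_sq]
  refine mul_le_mul_of_nonneg_left (le_of_eq ?_) zero_le_two
  refine tsum_nat_eq_tsum_int
    (f := fun k : ℤ => (1 + (k : ℝ) ^ 2) ^ (1 / 2 : ℝ) * ‖fourierCoeff w.toL2 k‖ ^ 2) fun k hk => ?_
  rw [show fourierCoeff w.toL2 k = 0 from w.2.1 k hk]
  simp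

/-- The truncation of a function to the frequencies `0 ≤ k < N`. -/
def lowPart (f : L2) (N : ℕ) : C(Circ, ℂ) :=
  ∑ k ∈ Finset.range N, fourierCoeff f k • fourier (k : ℤ)

lemma coeff_lowPart (f : L2) (N : ℕ) (k : ℤ) :
    fourierCoeff (lowPart f N) k = if 0 ≤ k ∧ k < N then fourierCoeff f k else 0 := by
  induction N with
  | zero =>
    rw [if_neg (by simp), lowPart, Finset.sum_range_zero, ← coeff_contToL2, map_zero, coeff_zero]
  | succ N ih =>
    have : lowPart f (N + 1) = lowPart f N + fourierCoeff f N • fourier (N : ℤ) :=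
      Finset.sum_range_succ _ _
    rw [this, coeff_cont_add, coeff_cont_smul, ih, fourierCoeff_fourier, Pi.single_apply]
    by_cases hk : k = N
    · subst hk
      simp
    · rw [if_neg hk, mul_zero, add_zero]
      congr 1
      push_cast
      simp only [eq_iff_iff]
      omega

/-- Cauchy–Schwarz with the weights 1 + k bounds the sum of |ŵ(k)| by the energy and a harmonic sum.
The resulting √(log N) replaces the missing embedding of H^{1/2} in L^∞. -/
lemma norm_lowPart_le (w : HPlus (1 / 2)) (N : ℕ) (x : Circ) :
    ‖lowPart w.toL2 N x‖ ≤ √(1 + Real.log N) * √(halfEnergy w) := by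
  have h1 : ‖lowPart w.toL2 N x‖ ≤ ∑ k ∈ Finset.range N, ‖fourierCoeff w.toL2 k‖ := by
    rw [lowPart, ContinuousMap.sum_apply]
    refine (norm_sum_le _ _).trans (Finset.sum_le_sum fun k _ => ?_)
    rw [ContinuousMap.smul_apply, norm_smul, fourier_apply, Circle.norm_coe, mul_one]
  refine h1.trans ?_
  rw [← Real.sqrt_mul' _ (halfEnergy_nonneg w)]
  refine Real.le_sqrt_of_sq_le ?_
  have h2 := Finset.sum_mul_sq_le_sq_mul_sq (Finset.range N) (fun k => (√(1 + (k : ℝ)))⁻¹)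
    (fun k => √(1 + (k : ℝ)) * ‖fourierCoeff w.toL2 k‖)
  have h3 : ∀ k : ℕ, (√(1 + (k : ℝ)))⁻¹ * (√(1 + (k : ℝ)) * ‖fourierCoeff w.toL2 k‖)
      = ‖fourierCoeff w.toL2 k‖ := fun k =>
    inv_mul_cancel_left₀ (Real.sqrt_pos.mpr (by positivity)).ne' _
  have h4 : ∀ k : ℕ, (√(1 + (k : ℝ)) * ‖fourierCoeff w.toL2 k‖) ^ 2
      = (1 + (k : ℝ)) * ‖fourierCoeff w.toL2 k‖ ^ 2 := fun k => by
    rw [mul_pow, Real.sq_sqrt (by positivity)]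
  have h5 : ∀ k : ℕ, ((√(1 + (k : ℝ)))⁻¹) ^ 2 = ((k : ℝ) + 1)⁻¹ := fun k => by
    rw [inv_pow, Real.sq_sqrt (by positivity), add_comm]
  simp only [h3, h4, h5] at h2
  refine h2.trans (mul_le_mul ?_ ?_ ?_ ?_)
  · have := harmonic_le_one_add_log N
    rw [harmonic] at this
    push_cast at this
    exact this
  · exact (summable_halfEnergy w).sum_le_tsum _ fun k _ => by positivity
  · exact Finset.sum_nonneg fun k _ => by positivity
  · have := Real.log_natCast_nonneg N
    linarith

/-- The remainder after truncation to the frequencies `0 ≤ k < N`. -/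
def highPart (f : L2) (N : ℕ) : L2 := f - contToL2 (lowPart f N)

lemma integral_highPart_le (w : HPlus (1 / 2)) (N : ℕ) :
    ∫ x, ‖highPart w.toL2 N x‖ ^ 2 ∂circMeasure ≤ halfEnergy w / (1 + N) := by
  have hc : ∀ k : ℤ, fourierCoeff (highPart w.toL2 N) k
      = if (N : ℤ) ≤ k then fourierCoeff w.toL2 k else 0 := by
    intro k
    rw [highPart, coeff_sub, coeff_contToL2, coeff_lowPart]
    rcases lt_or_ge k 0 with hk | hk
    · rw [show fourierCoeff w.toL2 k = 0 from w.2.1 k hk]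
      simp
    · by_cases hN : (N : ℤ) ≤ k
      · rw [if_neg (by omega), if_pos hN, sub_zero]
      · rw [if_pos (by omega), if_neg hN, sub_self]
  rw [← tsum_sq_fourierCoeff, ← tsum_nat_eq_tsum_int (fun k hk => by
    rw [hc k, if_neg (by omega)]; simp), halfEnergy, ← tsum_div_const]
  have hs := (summable_halfEnergy w).div_const (1 + (N : ℝ))
  have hle : ∀ k : ℕ, ‖fourierCoeff (highPart w.toL2 N) k‖ ^ 2
      ≤ (1 + (k : ℝ)) * ‖fourierCoeff w.toL2 k‖ ^ 2 / (1 + (N : ℝ)) := by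
    intro k
    rw [hc k, le_div_iff₀ (by positivity), mul_comm]
    split_ifs with hN
    · have : (N : ℝ) ≤ k := by exact_mod_cast hN
      exact mul_le_mul_of_nonneg_right (by linarith) (by positivity)
    · rw [norm_zero, zero_pow two_ne_zero, mul_zero]
      positivity
  exact (Summable.of_nonneg_of_le (fun k => by positivity) hle hs).tsum_le_tsum hle hs

/-- The Fourier coefficients of `f²`. -/
lemma coeff_mul_self (f : L2) (n : ℤ) :
    fourierCoeff (fun x => f x * f x) n
      = ∑' k : ℤ, fourierCoeff f (n - k) * fourierCoeff f k := by
  have hm : MemLp (fun x => conj (f x)) 2 circMeasure := (Lp.memLp f).star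
  set g₀ : L2 := hm.toLp _ with hg₀
  set g : L2 := (memLp_fourier_mul n g₀).toLp _ with hg
  have hg₀x : (g₀ : Circ → ℂ) =ᵐ[circMeasure] fun x => conj (f x) := hm.coeFn_toLp
  have hgx : (g : Circ → ℂ) =ᵐ[circMeasure] fun x => fourier n x * g₀ x :=
    (memLp_fourier_mul n g₀).coeFn_toLp
  have h1 : fourierCoeff (fun x => f x * f x) n = inner ℂ g f := by
    rw [L2.inner_def, fourierCoeff]
    refine integral_congr_ae ?_
    filter_upwards [hg₀x, hgx] with x h1 h2
    rw [h2, h1]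
    simp only [RCLike.inner_apply, map_mul, smul_eq_mul, fourier_neg, Complex.conj_conj]
    ring
  have hgc : ∀ k, fourierCoeff g k = conj (fourierCoeff f (n - k)) := by
    intro k
    rw [hg, coeff_toLp, coeff_fourier_mul, congrFun (fourierCoeff_congr_ae hg₀x) (k - n)]
    unfold fourierCoeff
    rw [← integral_conj]
    refine integral_congr_ae (Eventually.of_forall fun x => ?_)
    simp only [smul_eq_mul, map_mul, ← fourier_neg, neg_sub]
  rw [h1, ← inner_coeffSeq, lp.inner_eq_tsum]
  refine tsum_congr fun k => ?_
  change inner ℂ (fourierCoeff g k) (fourierCoeff f k) = _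
  rw [hgc, RCLike.inner_apply, Complex.conj_conj, mul_comm]

lemma coeff_mul_self_of_neg (w : HPlus (1 / 2)) {n : ℤ} (hn : n < 0) :
    fourierCoeff (fun x => w.toL2 x * w.toL2 x) n = 0 := by
  rw [coeff_mul_self, ← tsum_zero (α := ℂ) (β := ℤ)]
  refine tsum_congr fun k => ?_
  rcases lt_or_ge k 0 with hk | hk
  · rw [show fourierCoeff w.toL2 k = 0 from w.2.1 k hk, mul_zero]
  · rw [show fourierCoeff w.toL2 (n - k) = 0 from w.2.1 _ (by omega), zero_mul]

/-- Cauchy–Schwarz on a convolution of n + 1 terms costs a factor n + 1, which (1 + k)(1 + n - k)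
absorbs. The right side is then a term of the Cauchy product of the series of `halfEnergy` with
itself, as the L⁴ bound needs. -/
lemma norm_coeff_mul_self_sq_le (w : HPlus (1 / 2)) (n : ℕ) :
    ‖fourierCoeff (fun x => w.toL2 x * w.toL2 x) n‖ ^ 2 ≤
      ∑ k ∈ Finset.range (n + 1), (1 + (k : ℝ)) * ‖fourierCoeff w.toL2 k‖ ^ 2 *
        ((1 + ((n - k : ℕ) : ℝ)) * ‖fourierCoeff w.toL2 (n - k : ℕ)‖ ^ 2) := by
  have h1 : fourierCoeff (fun x => w.toL2 x * w.toL2 x) n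
      = ∑ k ∈ Finset.range (n + 1),
        fourierCoeff w.toL2 (n - k : ℕ) * fourierCoeff w.toL2 k := by
    rw [coeff_mul_self, ← Function.Injective.tsum_eq (g := fun n : ℕ => (n : ℤ)) Nat.cast_injective,
      tsum_eq_sum (s := Finset.range (n + 1))]
    · refine Finset.sum_congr rfl fun k hk => ?_
      rw [Nat.cast_sub (by simpa [Nat.lt_succ_iff] using hk)]
    · intro k hk
      have : (n : ℤ) - k < 0 := by
        simp only [Finset.mem_range, not_lt] at hk
        omega
      rw [show fourierCoeff w.toL2 ((n : ℤ) - k) = 0 from w.2.1 _ this, zero_mul]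
    · intro k hk
      have : 0 ≤ k := not_lt.mp fun h => hk (by
        change fourierCoeff w.toL2 ((n : ℤ) - k) * fourierCoeff w.toL2 k = 0
        rw [show fourierCoeff w.toL2 k = 0 from w.2.1 k h, mul_zero])
      exact ⟨k.toNat, by simp [this]⟩
  have h2 : ‖fourierCoeff (fun x => w.toL2 x * w.toL2 x) n‖
      ≤ ∑ k ∈ Finset.range (n + 1),
        ‖fourierCoeff w.toL2 (n - k : ℕ)‖ * ‖fourierCoeff w.toL2 k‖ := by
    rw [h1]
    refine (norm_sum_le _ _).trans (Finset.sum_le_sum fun k _ => ?_)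
    rw [norm_mul]
  refine (pow_le_pow_left₀ (norm_nonneg _) h2 2).trans (sq_sum_le_card_mul_sum_sq.trans ?_)
  rw [Finset.card_range, Finset.mul_sum]
  refine Finset.sum_le_sum fun k hk => ?_
  have hkn : k ≤ n := by simpa [Nat.lt_succ_iff] using hk
  have h3 : ((n + 1 : ℕ) : ℝ) ≤ (1 + (k : ℝ)) * (1 + ((n - k : ℕ) : ℝ)) := by
    rw [Nat.cast_sub hkn]
    have : (k : ℝ) ≤ n := by exact_mod_cast hkn
    push_cast
    nlinarith [mul_nonneg (Nat.cast_nonneg (α := ℝ) k) (sub_nonneg.mpr this)]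
  calc _ ≤ (1 + (k : ℝ)) * (1 + ((n - k : ℕ) : ℝ)) *
        (‖fourierCoeff w.toL2 (n - k : ℕ)‖ * ‖fourierCoeff w.toL2 k‖) ^ 2 :=
        mul_le_mul_of_nonneg_right h3 (by positivity)
    _ = _ := by ring

/-- The embedding `H^{1/2}₊ ⊆ L⁴`. -/
lemma integral_norm_pow_four_le (w : HPlus (1 / 2))
    (h4 : MemLp (fun x => w.toL2 x * w.toL2 x) 2 circMeasure) :
    ∫ x, (‖w.toL2 x‖ ^ 2) ^ 2 ∂circMeasure ≤ halfEnergy w ^ 2 := by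
  have h1 : ∫ x, (‖w.toL2 x‖ ^ 2) ^ 2 ∂circMeasure
      = ∑' n : ℕ, ‖fourierCoeff (fun x => w.toL2 x * w.toL2 x) n‖ ^ 2 := by
    have h2 : ∫ x, (‖w.toL2 x‖ ^ 2) ^ 2 ∂circMeasure
        = ∫ x, ‖(h4.toLp _ : L2) x‖ ^ 2 ∂circMeasure := by
      refine integral_congr_ae ?_
      filter_upwards [h4.coeFn_toLp] with x hx
      rw [hx, norm_mul, sq ‖w.toL2 x‖]
    rw [h2, ← tsum_sq_fourierCoeff, ← tsum_nat_eq_tsum_int]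
    · exact tsum_congr fun n => by rw [coeff_toLp]
    · intro k hk
      rw [coeff_toLp, coeff_mul_self_of_neg w hk]
      simp
  have hs := (summable_halfEnergy w).norm
  have h3 := summable_norm_sum_mul_range_of_summable_norm hs hs
  rw [h1, sq (halfEnergy w), halfEnergy, tsum_mul_tsum_eq_tsum_sum_range_of_summable_norm hs hs]
  exact (Summable.of_nonneg_of_le (fun n => by positivity) (norm_coeff_mul_self_sq_le w)
    h3.of_norm).tsum_le_tsum (norm_coeff_mul_self_sq_le w) h3.of_norm

/-! ### Uniqueness -/

/-- The notion of solution already demands that |u|²u be square integrable, and | |u|²u |² = |u|⁶.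
-/
lemma memLp_six_of_cubic {f : L2}
    (h : MemLp (fun x => (‖f x‖ : ℂ) ^ 2 * f x) 2 circMeasure) : MemLp f 6 circMeasure := by
  have hf := Lp.aestronglyMeasurable f
  rw [← memLp_norm_rpow_iff (q := 3) hf (by norm_num) (by norm_num)]
  have h6 : (6 : ℝ≥0∞) / 3 = 2 := by
    rw [eq_comm, ENNReal.eq_div_iff (by norm_num) (by norm_num)]
    norm_num
  rw [h6]
  refine (memLp_congr_norm h.1 (hf.norm.aemeasurable.pow_const _).aestronglyMeasurable
    (Eventually.of_forall fun x => ?_)).mp h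
  rw [norm_mul, norm_pow, Complex.norm_real, norm_norm, Real.norm_of_nonneg (by positivity)]
  simp only [ENNReal.toReal_ofNat, Real.rpow_ofNat]
  ring

lemma memLp_mul_self {f : L2} (h : MemLp f 4 circMeasure) :
    MemLp (fun x => f x * f x) 2 circMeasure := by
  have hf := Lp.aestronglyMeasurable f
  rw [← memLp_norm_rpow_iff (q := 2) hf (by norm_num) (by norm_num)] at h
  have h4 : (4 : ℝ≥0∞) / 2 = 2 := by
    rw [eq_comm, ENNReal.eq_div_iff (by norm_num) (by norm_num)]
    norm_num
  rw [h4] at h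
  refine (memLp_congr_norm h.1 (hf.mul hf) (Eventually.of_forall fun x => ?_)).mp h
  change _ = ‖f x * f x‖
  rw [norm_mul, Real.norm_of_nonneg (by positivity)]
  simp only [ENNReal.toReal_ofNat, Real.rpow_ofNat]
  ring

lemma integrable_norm_sq (f : L2) : Integrable (fun x => ‖f x‖ ^ 2) circMeasure :=
  (Lp.memLp f).norm.integrable_sq

lemma norm_sq_eq_integral (f : L2) : ‖f‖ ^ 2 = ∫ x, ‖f x‖ ^ 2 ∂circMeasure := by
  rw [← tsum_sq_fourierCoeff, ← norm_coeffSeq]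
  have h := lp.norm_rpow_eq_tsum (p := 2) (by norm_num) (coeffSeq f)
  simp only [ENNReal.toReal_ofNat, Real.rpow_ofNat] at h
  exact h

/-- A logarithmic interpolation estimate for the `L³` norm. -/
lemma integral_norm_cube_le (w : HPlus (1 / 2)) (h4 : MemLp w.toL2 4 circMeasure) (N : ℕ) :
    ∫ x, ‖w.toL2 x‖ ^ 3 ∂circMeasure ≤
      √(1 + Real.log N) * √(halfEnergy w) * ‖w.toL2‖ ^ 2
        + halfEnergy w * √(halfEnergy w / (1 + N)) := by
  have hsq := memLp_mul_self h4
  have hsq' : MemLp (fun x => ‖w.toL2 x‖ ^ 2) 2 circMeasure := by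
    refine hsq.norm.congr_norm ((Lp.aestronglyMeasurable _).norm.pow 2)
      (Eventually.of_forall fun x => ?_)
    simp [sq]
  set M := √(1 + Real.log N) * √(halfEnergy w)
  have hint1 : Integrable (fun x => M * ‖w.toL2 x‖ ^ 2) circMeasure :=
    (integrable_norm_sq w.toL2).const_mul M
  have hint2 : Integrable (fun x => ‖w.toL2 x‖ ^ 2 * ‖highPart w.toL2 N x‖) circMeasure :=
    hsq'.integrable_mul (Lp.memLp _).norm
  have hint3 : Integrable (fun x => ‖w.toL2 x‖ ^ 3) circMeasure :=
    (h4.mono_exponent (p := (3 : ℕ)) (by norm_num)).integrable_norm_pow (by norm_num)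
  have hle : ∫ x, ‖w.toL2 x‖ ^ 3 ∂circMeasure ≤
      ∫ x, (M * ‖w.toL2 x‖ ^ 2 + ‖w.toL2 x‖ ^ 2 * ‖highPart w.toL2 N x‖) ∂circMeasure := by
    refine integral_mono_ae hint3 (hint1.add hint2) ?_
    filter_upwards [Lp.coeFn_sub w.toL2 (contToL2 (lowPart w.toL2 N)),
      contToL2_coeFn (lowPart w.toL2 N)] with x hx hx'
    have h1 : w.toL2 x = lowPart w.toL2 N x + highPart w.toL2 N x := by
      rw [highPart, hx, Pi.sub_apply, hx']
      ring
    have h2 : ‖w.toL2 x‖ ≤ M + ‖highPart w.toL2 N x‖ := by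
      conv_lhs => rw [h1]
      exact (norm_add_le _ _).trans (add_le_add (norm_lowPart_le w N x) le_rfl)
    calc ‖w.toL2 x‖ ^ 3 = ‖w.toL2 x‖ ^ 2 * ‖w.toL2 x‖ := pow_succ _ 2
      _ ≤ ‖w.toL2 x‖ ^ 2 * (M + ‖highPart w.toL2 N x‖) :=
          mul_le_mul_of_nonneg_left h2 (by positivity)
      _ = _ := by ring
  refine hle.trans ?_
  rw [integral_add hint1 hint2, integral_const_mul, ← norm_sq_eq_integral]
  refine add_le_add le_rfl ?_
  have hcs := integral_mul_norm_le_Lp_mul_Lq (f := fun x => ‖w.toL2 x‖ ^ 2)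
    (g := fun x => ‖highPart w.toL2 N x‖) (p := 2) (q := 2) (μ := circMeasure)
    ((Real.holderConjugate_iff).mpr ⟨by norm_num, by norm_num⟩) (by simpa using hsq')
    (by simpa using (Lp.memLp (highPart w.toL2 N)).norm)
  simp only [norm_pow, norm_norm, Real.rpow_ofNat, ← Real.sqrt_eq_rpow] at hcs
  refine hcs.trans (mul_le_mul ?_ ?_ (Real.sqrt_nonneg _) (halfEnergy_nonneg w))
  · exact Real.sqrt_le_iff.mpr ⟨halfEnergy_nonneg w, integral_norm_pow_four_le w hsq⟩
  · exact Real.sqrt_le_sqrt (integral_highPart_le w N)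

/-- With w = v - u, |v|²v - |u|²u = |v|²w + (|v|² - |u|²)u. Paired with w, the first term is real
and disappears, so no power of v survives without a factor w, and the bounded function u controls
the rest. -/
lemma abs_im_cubic_sub_le (u v : ℂ) :
    |(((‖v‖ : ℂ) ^ 2 * v - (‖u‖ : ℂ) ^ 2 * u) * conj (v - u)).im| ≤
      2 * ‖u‖ ^ 2 * ‖v - u‖ ^ 2 + ‖u‖ * ‖v - u‖ ^ 3 := by
  have him : (((‖v‖ : ℂ) ^ 2 * v - (‖u‖ : ℂ) ^ 2 * u) * conj (v - u)).im
      = (‖u‖ ^ 2 - ‖v‖ ^ 2) * (conj u * (v - u)).im := by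
    rw [← Complex.ofReal_pow, ← Complex.ofReal_pow]
    simp only [Complex.mul_im, Complex.sub_re, Complex.sub_im, Complex.mul_re, Complex.conj_re,
      Complex.conj_im, Complex.ofReal_re, Complex.ofReal_im, map_sub]
    ring
  have h1 : |(conj u * (v - u)).im| ≤ ‖u‖ * ‖v - u‖ := by
    refine (Complex.abs_im_le_norm _).trans ?_
    rw [norm_mul, RCLike.norm_conj]
  have h2 : |‖u‖ - ‖v‖| ≤ ‖v - u‖ := by
    rw [norm_sub_rev]
    exact abs_norm_sub_norm_le u v
  have h3 : ‖v‖ ≤ ‖u‖ + ‖v - u‖ := norm_le_norm_add_norm_sub' v u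
  have h4 : |‖u‖ ^ 2 - ‖v‖ ^ 2| ≤ ‖v - u‖ * (2 * ‖u‖ + ‖v - u‖) := by
    rw [sq_sub_sq, abs_mul, abs_of_nonneg (add_nonneg (norm_nonneg u) (norm_nonneg v)), mul_comm]
    exact mul_le_mul h2 (by linarith) (by positivity) (norm_nonneg _)
  rw [him, abs_mul]
  calc _ ≤ ‖v - u‖ * (2 * ‖u‖ + ‖v - u‖) * (‖u‖ * ‖v - u‖) :=
        mul_le_mul h4 h1 (abs_nonneg _) (by positivity)
    _ = _ := by ring

/-- The function h has no negative frequencies, so Π can be dropped from the pairing. -/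
lemma inner_szego (h : hardy) {F : Circ → ℂ} (hF : MemLp F 2 circMeasure) :
    inner ℂ (h : L2) (szego F (memℓp_posCoeff_of_memLp hF) : L2)
      = ∫ x, F x * conj ((h : L2) x) ∂circMeasure := by
  have h1 : inner ℂ (h : L2) (szego F (memℓp_posCoeff_of_memLp hF) : L2)
      = inner ℂ (h : L2) (hF.toLp F) := by
    rw [← inner_coeffSeq, ← inner_coeffSeq, lp.inner_eq_tsum, lp.inner_eq_tsum]
    refine tsum_congr fun k => ?_
    change inner ℂ (fourierCoeff (h : L2) k)
        (fourierCoeff (szego F (memℓp_posCoeff_of_memLp hF) : L2) k)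
      = inner ℂ (fourierCoeff (h : L2) k) (fourierCoeff (hF.toLp F) k)
    rw [szego_coeff, coeff_toLp, posCoeff]
    split_ifs with hk
    · rfl
    · rw [h.2 k (by omega)]
      simp
  rw [h1, L2.inner_def]
  refine integral_congr_ae ?_
  filter_upwards [hF.coeFn_toLp] with x hx
  rw [hx, RCLike.inner_apply]

lemma inner_const (f : L2) (a : ℂ) :
    inner ℂ f (Lp.const 2 circMeasure a) = a * conj (fourierCoeff f 0) := by
  rw [L2.inner_def, ← integral_eq_coeff_zero, ← integral_conj, ← integral_const_mul]
  refine integral_congr_ae ?_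
  filter_upwards [Lp.coeFn_const 2 circMeasure a] with x hx
  rw [hx, RCLike.inner_apply]
  rfl

lemma real_inner_eq_re (f g : L2) : inner ℝ f g = (inner ℂ f g : ℂ).re := by
  rw [L2.inner_def, L2.inner_def]
  exact integral_re (L2.integrable_inner (𝕜 := ℂ) f g)

/-- The `L²` distance of two solutions, one of which is bounded, grows at most by a cubic term. -/
lemma exists_hasDerivAt_norm_sq_sub {α : ℝ} {u₀ v₀ : HPlus (1 / 2)} {u v : ℝ → HPlus (1 / 2)}
    (hu : IsSolution α u₀ u) (hv : IsSolution α v₀ v) {B t : ℝ}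
    (hB : ∀ᵐ x ∂circMeasure, ‖(u t).toL2 x‖ ≤ B) :
    MemLp (v t - u t).toL2 4 circMeasure ∧ ∃ g' : ℝ,
      HasDerivAt (fun t => ‖(v t - u t).toL2‖ ^ 2) g' t ∧
      |g'| ≤ 4 * B ^ 2 * ‖(v t - u t).toL2‖ ^ 2
        + 2 * B * ∫ x, ‖(v t - u t).toL2 x‖ ^ 3 ∂circMeasure := by
  obtain ⟨hFu, u', hu', hue⟩ := hu.equation t
  obtain ⟨hFv, v', hv', hve⟩ := hv.equation t
  have h4 : MemLp (v t - u t).toL2 4 circMeasure := by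
    have h6 := (memLp_six_of_cubic hFv).sub (memLp_six_of_cubic hFu)
    refine (MemLp.mono_exponent ?_ (show (4 : ℝ≥0∞) ≤ 6 by norm_num))
    exact (memLp_congr_ae (Lp.coeFn_sub (v t).toL2 (u t).toL2)).mpr h6
  refine ⟨h4, _, (hv'.sub hu').norm_sq, ?_⟩
  set w : L2 := (v t - u t).toL2 with hw
  have hwx : (w : Circ → ℂ) =ᵐ[circMeasure] fun x => (v t).toL2 x - (u t).toL2 x :=
    Lp.coeFn_sub (v t).toL2 (u t).toL2
  have hre : (inner ℂ w (v' - u') : ℂ).re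
      = ∫ x, ((((‖(v t).toL2 x‖ : ℂ) ^ 2 * (v t).toL2 x
          - (‖(u t).toL2 x‖ : ℂ) ^ 2 * (u t).toL2 x) * conj (w x)).im) ∂circMeasure := by
    have hint : ∀ {F : Circ → ℂ}, MemLp F 2 circMeasure →
        Integrable (fun x => F x * conj (w x)) circMeasure := fun hF =>
      hF.integrable_mul (Lp.memLp w).star
    -- In the difference of the two equations paired with w, the α-term is α|ŵ(0)|². It is real, so
    -- it does not contribute to the growth of the L² norm.
    have hI : Complex.I * (inner ℂ w (v' - u') : ℂ)
        = (∫ x, ((‖(v t).toL2 x‖ : ℂ) ^ 2 * (v t).toL2 x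
          - (‖(u t).toL2 x‖ : ℂ) ^ 2 * (u t).toL2 x) * conj (w x) ∂circMeasure)
          + α * (fourierCoeff w 0 * conj (fourierCoeff w 0)) := by
      have hsub : (fun x => ((‖(v t).toL2 x‖ : ℂ) ^ 2 * (v t).toL2 x
          - (‖(u t).toL2 x‖ : ℂ) ^ 2 * (u t).toL2 x) * conj (w x))
          = fun x => (‖(v t).toL2 x‖ : ℂ) ^ 2 * (v t).toL2 x * conj (w x)
            - (‖(u t).toL2 x‖ : ℂ) ^ 2 * (u t).toL2 x * conj (w x) := by
        funext x
        ring
      have h1 := inner_szego (v t - u t).toHardy hFv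
      have h2 := inner_szego (v t - u t).toHardy hFu
      have h3 : fourierCoeff w 0 = fourierCoeff (v t).toL2 0 - fourierCoeff (u t).toL2 0 :=
        coeff_sub _ _ 0
      change inner ℂ w _ = ∫ x, _ * conj (w x) ∂circMeasure at h1
      change inner ℂ w _ = ∫ x, _ * conj (w x) ∂circMeasure at h2
      rw [← inner_smul_right, smul_sub, hve, hue, hsub, integral_sub (hint hFv) (hint hFu), ← h1,
        ← h2, inner_sub_right, inner_add_right, inner_add_right, inner_const, inner_const,
        integral_eq_coeff_zero, integral_eq_coeff_zero]
      linear_combination (-(α : ℂ) * conj (fourierCoeff w 0)) * h3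
    have him := congrArg Complex.im hI
    rw [Complex.I_mul_im] at him
    rw [him, Complex.add_im, Complex.mul_conj, ← Complex.ofReal_mul, Complex.ofReal_im, add_zero]
    exact (integral_im (hint (hFv.sub hFu))).symm
  change |2 * inner ℝ w (v' - u')| ≤ _
  rw [real_inner_eq_re, hre, abs_mul, abs_two]
  have h3 : Integrable (fun x => ‖w x‖ ^ 3) circMeasure :=
    (h4.mono_exponent (p := (3 : ℕ)) (by norm_num)).integrable_norm_pow (by norm_num)
  have hint2 := (integrable_norm_sq w).const_mul (2 * B ^ 2)
  have hint3 := h3.const_mul B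
  have hle : |∫ x, ((((‖(v t).toL2 x‖ : ℂ) ^ 2 * (v t).toL2 x
      - (‖(u t).toL2 x‖ : ℂ) ^ 2 * (u t).toL2 x) * conj (w x)).im) ∂circMeasure|
      ≤ ∫ x, (2 * B ^ 2 * ‖w x‖ ^ 2 + B * ‖w x‖ ^ 3) ∂circMeasure := by
    rw [← Real.norm_eq_abs]
    refine norm_integral_le_of_norm_le (hint2.add hint3) ?_
    filter_upwards [hwx, hB] with x hx hBx
    rw [hx, Real.norm_eq_abs]
    refine (abs_im_cubic_sub_le _ _).trans (add_le_add ?_ ?_)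
    · have := pow_le_pow_left₀ (norm_nonneg _) hBx 2
      exact mul_le_mul_of_nonneg_right (by linarith) (by positivity)
    · exact mul_le_mul_of_nonneg_right hBx (by positivity)
  rw [integral_add hint2 hint3, integral_const_mul, integral_const_mul, ← norm_sq_eq_integral]
    at hle
  linarith

/-! ### Gronwall's inequality with logarithmic losses -/

/-- With x = √(1 + log N), the factor 1/√(1 + N) is at most exp((1 - x²)/2), and the quadratic -x²/2
dominates the linear bx in the exponent. -/
lemma tendsto_loss (C a b : ℝ) :
    Tendsto (fun N : ℕ => C * √(1 / (1 + (N : ℝ))) * Real.exp (a + b * √(1 + Real.log N)))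
      atTop (𝓝 0) := by
  have hx : Tendsto (fun N : ℕ => √(1 + Real.log N)) atTop atTop :=
    Real.tendsto_sqrt_atTop.comp (tendsto_atTop_add_const_left _ _
      (Real.tendsto_log_atTop.comp tendsto_natCast_atTop_atTop))
  have hpoly : Tendsto (fun x : ℝ => x * (b - x / 2) + (a + 1 / 2)) atTop atBot := by
    refine tendsto_atBot_add_const_right _ _ (Tendsto.atTop_mul_atBot₀ tendsto_id ?_)
    refine tendsto_atBot_add_const_left _ _ ?_
    exact tendsto_neg_atTop_atBot.comp (tendsto_id.atTop_div_const two_pos)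
  have hlim := (Real.tendsto_exp_atBot.comp (hpoly.comp hx)).const_mul |C|
  rw [mul_zero] at hlim
  refine squeeze_zero_norm' ?_ hlim
  filter_upwards [eventually_ge_atTop 1] with N hN
  have hN' : (1 : ℝ) ≤ N := by exact_mod_cast hN
  set x := √(1 + Real.log N) with hxdef
  have hx2 : x ^ 2 = 1 + Real.log N := Real.sq_sqrt (by have := Real.log_nonneg hN'; linarith)
  have h1 : √(1 / (1 + (N : ℝ))) ≤ Real.exp ((1 - x ^ 2) / 2) := by
    rw [Real.sqrt_le_left (Real.exp_pos _).le, ← Real.exp_nat_mul, hx2]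
    have h2 : ((2 : ℕ) : ℝ) * ((1 - (1 + Real.log N)) / 2) = -Real.log N := by
      push_cast
      ring
    rw [h2, Real.exp_neg, Real.exp_log (by linarith), one_div]
    exact inv_anti₀ (by linarith) (by linarith)
  rw [norm_mul, norm_mul, Real.norm_eq_abs C, Real.norm_of_nonneg (Real.sqrt_nonneg _),
    Real.norm_of_nonneg (Real.exp_pos _).le, mul_assoc]
  refine mul_le_mul_of_nonneg_left ?_ (abs_nonneg C)
  refine (mul_le_mul_of_nonneg_right h1 (Real.exp_pos _).le).trans (le_of_eq ?_)
  rw [← Real.exp_add]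
  change _ = Real.exp (x * (b - x / 2) + (a + 1 / 2))
  congr 1
  ring

/-- A nonnegative function that satisfies a differential inequality with logarithmic losses, and
vanishes at `0`, vanishes for positive times. -/
lemma eq_zero_of_log_gronwall {g g' : ℝ → ℝ} {T A B C : ℝ} (hT : 0 ≤ T) (hA : 0 < A)
    (hB : 0 ≤ B) (hC : 0 ≤ C)
    (hg : ∀ t ∈ Set.Icc 0 T, HasDerivAt g (g' t) t) (hg0 : g 0 = 0) (hnn : ∀ t, 0 ≤ g t)
    (hb : ∀ t ∈ Set.Icc 0 T, ∀ N : ℕ,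
      |g' t| ≤ (A + B * √(1 + Real.log N)) * g t + C * √(1 / (1 + N))) :
    g T = 0 := by
  have hle : ∀ N : ℕ, g T ≤ C / A * √(1 / (1 + (N : ℝ)))
      * Real.exp (A * T + B * T * √(1 + Real.log N)) := by
    intro N
    set K := A + B * √(1 + Real.log N) with hK
    have hKA : A ≤ K := le_add_of_nonneg_right (by positivity)
    have hKpos : 0 < K := hA.trans_le hKA
    set ε := C * √(1 / (1 + (N : ℝ))) with hε
    have hε0 : 0 ≤ ε := by positivity
    have h := norm_le_gronwallBound_of_norm_deriv_right_le (f := g) (f' := g') (δ := 0) (K := K)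
      (ε := ε) (a := 0) (b := T) (fun t ht => (hg t ht).continuousAt.continuousWithinAt)
      (fun t ht => (hg t (Set.Ico_subset_Icc_self ht)).hasDerivWithinAt) (by simp [hg0])
      (fun t ht => by
        rw [Real.norm_eq_abs, Real.norm_of_nonneg (hnn t)]
        exact hb t (Set.Ico_subset_Icc_self ht) N) T ⟨hT, le_rfl⟩
    rw [Real.norm_of_nonneg (hnn T), gronwallBound_of_K_ne_0 hKpos.ne', sub_zero] at h
    simp only [zero_mul, zero_add] at h
    refine h.trans ?_
    -- Replacing K by A, which does not depend on N, puts the bound in the form covered by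
    -- `tendsto_loss`.
    have h1 : ε / K ≤ ε / A := div_le_div_of_nonneg_left hε0 hA hKA
    have h2 : Real.exp (K * T) - 1 ≤ Real.exp (K * T) := by linarith
    have h3 : 0 ≤ Real.exp (K * T) - 1 := by
      have := Real.one_le_exp (mul_nonneg hKpos.le hT)
      linarith
    refine (mul_le_mul h1 h2 h3 (by positivity)).trans (le_of_eq ?_)
    rw [hε, hK]
    have : (A + B * √(1 + Real.log N)) * T = A * T + B * T * √(1 + Real.log N) := by ring
    rw [this]
    ring
  exact le_antisymm (ge_of_tendsto' (tendsto_loss _ _ _) hle) (hnn T)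

/-- A bounded solution is the only solution with its initial value. -/
theorem IsSolution.eq_of_bounded {α : ℝ} {u₀ : HPlus (1 / 2)} {u v : ℝ → HPlus (1 / 2)}
    (hu : IsSolution α u₀ u) (hv : IsSolution α u₀ v) {B : ℝ} (hB0 : 0 < B)
    (hB : ∀ t, ∀ᵐ x ∂circMeasure, ‖(u t).toL2 x‖ ≤ B) : v = u := by
  have hcont : Continuous fun t => v t - u t := hv.continuous.sub hu.continuous
  choose h4 g' hg' hg'le using fun t => exists_hasDerivAt_norm_sq_sub hu hv (hB t)
  set g : ℝ → ℝ := fun t => ‖(v t - u t).toL2‖ ^ 2 with hgdef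
  have hg0 : g 0 = 0 := by
    have h0 : (v 0 - u 0).toL2 = 0 := by
      rw [hu.initial, hv.initial, sub_self]
      rfl
    simp only [hgdef, h0, norm_zero]
    norm_num
  -- R bounds the energy of the difference on [-T, T]; it is finite because both solutions are
  -- continuous in H^{1/2}.
  have hest : ∀ T : ℝ, ∃ R : ℝ, 0 ≤ R ∧ ∀ t ∈ Set.Icc (-T) T, ∀ N : ℕ,
      |g' t| ≤ (4 * B ^ 2 + 2 * B * √R * √(1 + Real.log N)) * g t
        + 2 * B * R * √R * √(1 / (1 + N)) := by
    intro T
    obtain ⟨M, hM⟩ := (isCompact_Icc (a := -T) (b := T)).exists_bound_of_continuousOn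
      hcont.continuousOn
    refine ⟨2 * M ^ 2, by positivity, fun t ht N => ?_⟩
    set R := 2 * M ^ 2
    have hE : halfEnergy (v t - u t) ≤ R :=
      (halfEnergy_le _).trans (mul_le_mul_of_nonneg_left
        (pow_le_pow_left₀ (norm_nonneg _) (hM t ht) 2) zero_le_two)
    have hE0 := halfEnergy_nonneg (v t - u t)
    have h3 := integral_norm_cube_le (v t - u t) (h4 t) N
    have hs : √(halfEnergy (v t - u t)) ≤ √R := Real.sqrt_le_sqrt hE
    have hs' : √(halfEnergy (v t - u t) / (1 + N)) ≤ √R * √(1 / (1 + N)) := by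
      rw [div_eq_mul_one_div, Real.sqrt_mul hE0]
      exact mul_le_mul_of_nonneg_right hs (Real.sqrt_nonneg _)
    have h5 : √(1 + Real.log N) * √(halfEnergy (v t - u t)) * g t
        ≤ √(1 + Real.log N) * √R * g t :=
      mul_le_mul_of_nonneg_right (mul_le_mul_of_nonneg_left hs (Real.sqrt_nonneg _)) (sq_nonneg _)
    have h6 : halfEnergy (v t - u t) * √(halfEnergy (v t - u t) / (1 + N))
        ≤ R * (√R * √(1 / (1 + N))) :=
      mul_le_mul hE hs' (Real.sqrt_nonneg _) (hE0.trans hE)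
    have h7 := mul_le_mul_of_nonneg_left (h3.trans (add_le_add h5 h6))
      (show 0 ≤ 2 * B by positivity)
    calc |g' t| ≤ _ := hg'le t
      _ ≤ _ := add_le_add le_rfl h7
      _ = _ := by ring
  have hzero : ∀ t, g t = 0 := by
    intro t
    obtain ⟨R, hR, hb⟩ := hest |t|
    have hmem : ∀ s ∈ Set.Icc 0 |t|, s ∈ Set.Icc (-|t|) |t| ∧ -s ∈ Set.Icc (-|t|) |t| := by
      intro s hs
      have := abs_nonneg t
      refine ⟨⟨?_, hs.2⟩, ⟨?_, ?_⟩⟩ <;> linarith [hs.1, hs.2]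
    have hpos : g |t| = 0 := eq_zero_of_log_gronwall (A := 4 * B ^ 2) (B := 2 * B * √R)
      (C := 2 * B * R * √R) (abs_nonneg t) (by positivity) (by positivity) (by positivity)
      (fun s _ => hg' s) hg0 (fun s => sq_nonneg _) fun s hs N => hb s (hmem s hs).1 N
    -- The bound is on |g'|, so it is invariant under time reversal.
    have hneg : g (-|t|) = 0 := by
      refine eq_zero_of_log_gronwall (g := fun s => g (-s)) (g' := fun s => -g' (-s))
        (A := 4 * B ^ 2) (B := 2 * B * √R) (C := 2 * B * R * √R) (abs_nonneg t) (by positivity)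
        (by positivity) (by positivity) (fun s _ => ?_) (by simpa using hg0)
        (fun s => sq_nonneg _) fun s hs N => ?_
      · have h := (hg' (-s)).scomp s (hasDerivAt_neg s)
        rw [neg_one_smul] at h
        exact h
      · rw [abs_neg]
        exact hb (-s) (hmem s hs).2 N
    rcases abs_choice t with h | h
    · rwa [h] at hpos
    · rwa [h, neg_neg] at hneg
  funext t
  have h0 : ‖(v t - u t).toL2‖ = 0 := by simpa [hgdef] using hzero t
  have h1 : (v t).toL2 - (u t).toL2 = 0 := norm_eq_zero.mp h0
  exact Subtype.ext (sub_eq_zero.mp h1)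

/-! ### The main theorem -/

lemma norm_ratFun_le {p b c : ℂ} {r D : ℝ} (hr : r < 1) (hp : ‖p‖ ≤ r) (hb : ‖b‖ ≤ D)
    (hc : ‖c‖ ≤ D) (x : Circ) : ‖ratFun p b c x‖ ≤ D + D / (1 - r) := by
  have hp1 : ‖p‖ < 1 := hp.trans_lt hr
  have hD : 0 ≤ D := (norm_nonneg _).trans hb
  have h1 : 1 - r ≤ ‖1 - p * zFun x‖ := by
    have h := norm_sub_norm_le (1 : ℂ) (p * zFun x)
    rw [norm_one, norm_mul, norm_zFun, mul_one] at h
    linarith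
  change ‖b * 1 + c * (zFun x * resolv p x)‖ ≤ _
  refine (norm_add_le _ _).trans (add_le_add (by simpa using hb) ?_)
  rw [norm_mul, norm_mul, norm_zFun, one_mul, resolv_apply hp1, norm_inv, ← div_eq_mul_inv]
  exact div_le_div₀ hD hc (by linarith) h1

lemma one_sub_mul_conj (p : ℂ) : 1 - p * conj p = ((1 - ‖p‖ ^ 2 : ℝ) : ℂ) := by
  rw [Complex.mul_conj, Complex.normSq_eq_norm_sq]
  push_cast
  ring

lemma norm_one_sub_mul_conj {p : ℂ} (hp : ‖p‖ < 1) :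
    ‖1 - p * conj p‖ = 1 - ‖p‖ ^ 2 ∧ 0 < 1 - ‖p‖ ^ 2 := by
  have h : 0 < 1 - ‖p‖ ^ 2 := by
    have := norm_nonneg p
    nlinarith
  rw [one_sub_mul_conj, Complex.norm_real, Real.norm_of_nonneg h.le]
  exact ⟨rfl, h⟩

/-- For initial data in `𝓛(1)` with parameters in a compact set there is exactly one solution, and
its parameters remain in a compact set. -/
theorem exists_unique_solution_of_bounds {α : ℝ} (hα : α < 0) {ρ : ℝ} (hρ0 : 0 ≤ ρ) (hρ : ρ < 1)
    (D : ℝ) :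
    ∃ r D' : ℝ, r < 1 ∧ ∀ u₀ ∈ rankSet 1,
      ‖fourierCoeff u₀.toL2 2 / fourierCoeff u₀.toL2 1‖ ≤ ρ → ‖fourierCoeff u₀.toL2 0‖ ≤ D →
      ‖fourierCoeff u₀.toL2 1‖ ≤ D →
      ∃ u : ℝ → HPlus (1 / 2), IsSolution α u₀ u ∧
        (∀ v : ℝ → HPlus (1 / 2), IsSolution α u₀ v → v = u) ∧
        ∀ t, ∃ p b c : ℂ, ‖p‖ ≤ r ∧ ‖b‖ ≤ D' ∧ ‖c‖ ≤ D' ∧ c ≠ 0 ∧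
          (u t).toL2 = contToL2 (ratFun p b c) := by
  have hρ2 : 0 < 1 - ρ ^ 2 := by nlinarith
  -- The coordinate is η = c / (1 - |p|²), so the bound on c has to be divided by the least value of
  -- 1 - |p|².
  set D₀ := D / (1 - ρ ^ 2) with hD₀
  obtain ⟨r, hr0, hr1, hr⟩ := exists_uniform_bound hα hρ0 hρ D₀
  refine ⟨r, 2 * D₀, hr1, fun u₀ hu₀ h1 h2 h3 => ?_⟩
  obtain ⟨p, hp, hc, hpdef, hu⟩ := exists_params_of_mem_rankSet hu₀
  rw [← hpdef] at h1
  set b := fourierCoeff u₀.toL2 0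
  set c := fourierCoeff u₀.toL2 1
  obtain ⟨hn, hn0⟩ := norm_one_sub_mul_conj hp
  have hne : 1 - p * conj p ≠ 0 := norm_ne_zero_iff.mp (hn ▸ hn0.ne')
  have hD : 0 ≤ D := (norm_nonneg _).trans h2
  set x₀ : ℂ × ℂ × ℂ := (p, b, c / (1 - p * conj p)) with hx₀
  have he : x₀.2.2 ≠ 0 := div_ne_zero hc hne
  have hres : residue x₀ = c := div_mul_cancel₀ c hne
  have hb' : ‖x₀.2.1‖ ≤ D₀ := by
    refine h2.trans ?_
    rw [hD₀, le_div_iff₀ hρ2]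
    nlinarith [sq_nonneg ρ]
  have he' : ‖x₀.2.2‖ ≤ D₀ := by
    change ‖c / (1 - p * conj p)‖ ≤ _
    rw [norm_div, hn]
    have := pow_le_pow_left₀ (norm_nonneg p) h1 2
    exact div_le_div₀ hD h3 hρ2 (by linarith)
  obtain ⟨γ, hγ0, hγ, hγl⟩ := exists_trajectory hα (x₀ := x₀) hp he
  have hγb := fun t => hr x₀ (γ t) h1 he hb' he' (hγl t)
  have hγp : ∀ t, ‖(γ t).1‖ < 1 := fun t => (hγb t).1.trans_lt hr1
  have hγc : ∀ t, ‖residue (γ t)‖ ≤ 2 * D₀ := by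
    intro t
    have h4 := (hγb t).2.2
    have h5 := norm_one_sub_mul_conj (hγp t)
    have h6 := norm_nonneg (γ t).2.2
    rw [residue, norm_mul, h5.1]
    nlinarith [sq_nonneg ‖(γ t).1‖, h5.2]
  have hsol := isSolution_of_trajectory hγ hγp
  have hinit : ratSobolev (1 / 2) (γ 0).1 (γ 0).2.1 (residue (γ 0)) (hγp 0) = u₀ := by
    apply Subtype.ext
    change contToL2 (ratFun (γ 0).1 (γ 0).2.1 (residue (γ 0))) = u₀.toL2
    rw [hγ0, hres, hu]
  rw [hinit] at hsol
  refine ⟨_, hsol, fun v hv => ?_, fun t => ⟨(γ t).1, (γ t).2.1, residue (γ t), (hγb t).1,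
    (hγb t).2.1, hγc t, ?_, rfl⟩⟩
  · have hD₀0 : 0 ≤ D₀ := div_nonneg hD hρ2.le
    have hr' : 0 < 1 - r := by linarith
    refine hsol.eq_of_bounded hv (B := 2 * D₀ + 2 * D₀ / (1 - r) + 1) (by positivity) fun t => ?_
    filter_upwards [contToL2_coeFn (ratFun (γ t).1 (γ t).2.1 (residue (γ t)))] with x hx
    rw [ratSobolev_toL2, hx]
    exact (norm_ratFun_le hr1 (hγb t).1 (hγb t).2.1 (hγc t) x).trans (by linarith)
  · obtain ⟨-, h6, -⟩ := bounds_of_mem_levelSet hα hp he (hγl t)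
    have h7 := norm_one_sub_mul_conj (hγp t)
    refine mul_ne_zero (norm_ne_zero_iff.mp ?_) (norm_ne_zero_iff.mp ?_)
    · rw [h6]
      exact norm_ne_zero_iff.mpr he
    · rw [h7.1]
      exact h7.2.ne'

end AlphaSzego

end

theorem mainTheorem3 (α : ℝ) (hα : α < 0) :
    (∀ u₀ ∈ AlphaSzego.rankSet 1,
      ∃ u : ℝ → AlphaSzego.HPlus (1 / 2),
        AlphaSzego.IsSolution α u₀ u ∧
        (∀ v : ℝ → AlphaSzego.HPlus (1 / 2), AlphaSzego.IsSolution α u₀ v → v = u) ∧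
        (∀ t : ℝ, ∃ a b p : ℂ, ‖p‖ < 1 ∧ a + b * p ≠ 0 ∧
          (u t).toL2 =ᵐ[AlphaSzego.circMeasure]
            fun x => (a * AlphaSzego.zFun x + b) / (1 - p * AlphaSzego.zFun x)) ∧
        ∀ s : ℝ, 1 / 2 ≤ s → ∃ C : ℝ, ∀ t : ℝ, AlphaSzego.SobolevNormLT s (u t).toL2 C) ∧
    (∀ K : Set (AlphaSzego.HPlus (1 / 2)), K ⊆ AlphaSzego.rankSet 1 → IsCompact K →
      ∀ s : ℝ, 1 / 2 ≤ s → ∃ C : ℝ, ∀ u₀ ∈ K, ∀ u : ℝ → AlphaSzego.HPlus (1 / 2),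
        AlphaSzego.IsSolution α u₀ u → ∀ t : ℝ, AlphaSzego.SobolevNormLT s (u t).toL2 C) := by
  refine ⟨fun u₀ hu₀ => ?_, fun K hK hKc s _ => ?_⟩
  · obtain ⟨p₀, hp₀, -, hp₀', -⟩ := AlphaSzego.exists_params_of_mem_rankSet hu₀
    -- For a single datum, its own |p₀| serves as ρ.
    obtain ⟨r, D, hr, h⟩ := AlphaSzego.exists_unique_solution_of_bounds hα
      (norm_nonneg p₀) hp₀
      (max ‖fourierCoeff u₀.toL2 0‖ ‖fourierCoeff u₀.toL2 1‖)
    obtain ⟨u, hu, huniq, hform⟩ := h u₀ hu₀ (by rw [hp₀']) (le_max_left _ _) (le_max_right _ _)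
    refine ⟨u, hu, huniq, fun t => ?_, fun s _ => ?_⟩
    · obtain ⟨p, b, c, hp, -, -, hc, hut⟩ := hform t
      have hp1 : ‖p‖ < 1 := hp.trans_lt hr
      refine ⟨c - b * p, b, p, hp1, by rwa [sub_add_cancel], ?_⟩
      rw [hut]
      filter_upwards [AlphaSzego.contToL2_coeFn (AlphaSzego.ratFun p b c)] with x hx
      rw [hx, AlphaSzego.ratFun_apply hp1]
    · obtain ⟨C, hC⟩ := AlphaSzego.exists_sobolevNormLT s hr D
      refine ⟨C, fun t => ?_⟩
      obtain ⟨p, b, c, hp, hb, hc, -, hut⟩ := hform t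
      rw [hut]
      exact hC p b c hp hb hc
  · obtain ⟨ρ, D₀, hρ0, hρ, hbd⟩ := AlphaSzego.exists_bounds_of_isCompact hK hKc
    obtain ⟨r, D, hr, h⟩ := AlphaSzego.exists_unique_solution_of_bounds hα hρ0 hρ D₀
    obtain ⟨C, hC⟩ := AlphaSzego.exists_sobolevNormLT s hr D
    refine ⟨C, fun u₀ hu₀ v hv t => ?_⟩
    obtain ⟨h1, h2, h3⟩ := hbd u₀ hu₀
    -- By uniqueness the given solution is the constructed one, whose parameters are bounded
    -- uniformly over K.
    obtain ⟨u, -, huniq, hform⟩ := h u₀ (hK hu₀) h1 h2 h3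
    obtain ⟨p, b, c, hp, hb, hc, -, hut⟩ := hform t
    rw [huniq v hv, hut]
    exact hC p b c hp hb hc
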